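/- Let $\mathcal B_3=\langle \sigma_1,\sigma_2\mid \sigma_1\sigma_2\sigma_1=\sigma_2\sigma_1\sigma_2\rangle$ be the three-strand braid group, and let the three-component loop braid group $\mathcal{LB}_3$ be the group generated by $\sigma_1,\sigma_2,s_1,s_2$ subject to $$\sigma_1\sigma_2\sigma_1=\sigma_2\sigma_1\sigma_2,\quad s_1s_2s_1=s_2s_1s_2,\quad s_1^2=s_2^2=1,\quad s_1s_2\sigma_1=\sigma_2s_1s_2,\quad \sigma_1\sigma_2s_1=s_2\sigma_1\sigma_2 .$$ An extension of a representation $\rho:\mathcal B_3\to GL_d(\mathbb C)$ to $\mathcal{LB}_3$ is a representation $\rho':\mathcal{LB}_3\to GL_d(\mathbb C)$ with $\rho'(\sigma_i)=\rho(\sigma_i)$ for $i=1,2$; it is a standard extension if $\rho'(s_1s_2)=k\,\rho(\sigma_1\sigma_2)$ for some $k\in\mathbb C$. (1) If $d\le 5$, then every irreducible representation $\rho:\mathcal B_3\to GL_d(\mathbb C)$ has a standard extension to $\mathcal{LB}_3$; in particular it has an extension to $\mathcal{LB}_3$. (2) Let $\omega=e^{2\pi i/3}$ and $$A=\begin{pmatrix}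 1 & -\omega+1 & -\omega^2+1 & \omega-1 & \omega^2-1 & \omega-1\\ \omega^2-1 & \omega^2 & 0 & -\omega^2+1 & 0 & 0\\ \omega^2-1 & \omega^2-1 & \omega^2 & -\omega^2+1 & -\omega^2+1 & 0\\ 0 & \omega-1 & \omega^2-1 & -\omega & -\omega^2+1 & -\omega+1\\ -\omega^2+1 & -\omega^2+1 & 0 & \omega^2-1 & -1 & 0\\ -\omega^2+1 & -\omega^2+1 & -\omega^2+1 & \omega^2-1 & \omega^2-1 & -1 \end{pmatrix},$$ $$B=\begin{pmatrix} 1 & -\omega+1 & -\omega^2+1 & -\omega+1 & -\omega^2+1 & -\omega+1\\ \omega^2-1 & \omega^2 & 0 & \omega^2-1 & 0 & 0\\ \omega^2-1 & \omega^2-1 & \omega^2 & \omega^2-1 & \omega^2-1 & 0\\ 0 & -\omega+1 & -\omega^2+1 & -\omega & -\omega^2+1 & -\omega+1\\ \omega^2-1 & \omega^2-1 & 0 & \omega^2-1 & -1 & 0\\ \omega^2-1 & \omega^2-1 & \omega^2-1 & \omega^2-1 & \omega^2-1 & -1 \end{pmatrix}.$$ Then $\rho(\sigma_1)=A$, $\rho(\sigma_2)=B$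 defines an irreducible representation $\rho:\mathcal B_3\to GL_6(\mathbb C)$ which has no extension to $\mathcal{LB}_3$ (standard or otherwise). -/

import Mathlib

namespace LoopBraid

/-- The two generators of the three strand braid group. -/
inductive BraidGen : Type
  | sigma₁
  | sigma₂

/-- The four generators of the three component loop braid group. -/
inductive LoopGen : Type
  | sigma₁
  | sigma₂
  | s₁
  | s₂

/-- The braid relation, written as the word `σ₁σ₂σ₁(σ₂σ₁σ₂)⁻¹`. -/
def braidRels : Set (FreeGroup BraidGen) :=
  let a := FreeGroup.of BraidGen.sigma₁
  let b := FreeGroup.of BraidGen.sigma₂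
  {a * b * a * (b * a * b)⁻¹}

/-- The defining relations of the three component loop braid group, each equation `u = v` being
written as the word `u * v⁻¹`. In order: the braid relation for `σ₁, σ₂`; the braid relation for
`s₁, s₂`; `s₁² = 1` and `s₂² = 1`; `s₁s₂σ₁ = σ₂s₁s₂`; `σ₁σ₂s₁ = s₂σ₁σ₂`. -/
def loopRels : Set (FreeGroup LoopGen) :=
  let a := FreeGroup.of LoopGen.sigma₁
  let b := FreeGroup.of LoopGen.sigma₂
  let s := FreeGroup.of LoopGen.s₁
  let t := FreeGroup.of LoopGen.s₂
  {a * b * a * (b * a * b)⁻¹,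
    s * t * s * (t * s * t)⁻¹,
    s ^ 2,
    t ^ 2,
    s * t * a * (b * s * t)⁻¹,
    a * b * s * (t * a * b)⁻¹}

/-- Artin's braid group on three strands. -/
abbrev B3 : Type := PresentedGroup braidRels

/-- The three component loop braid group. -/
abbrev LB3 : Type := PresentedGroup loopRels

/-- The standard homomorphism from the braid group to the loop braid group on generators. -/
def inclGen : BraidGen → LB3
  | .sigma₁ => PresentedGroup.of LoopGen.sigma₁
  | .sigma₂ => PresentedGroup.of LoopGen.sigma₂

theorem inclGen_rels : ∀ r ∈ braidRels, FreeGroup.lift inclGen r = 1 := by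
  intro r hr
  have hr' : r = FreeGroup.of BraidGen.sigma₁ * FreeGroup.of BraidGen.sigma₂ *
      FreeGroup.of BraidGen.sigma₁ * (FreeGroup.of BraidGen.sigma₂ *
      FreeGroup.of BraidGen.sigma₁ * FreeGroup.of BraidGen.sigma₂)⁻¹ := hr
  subst hr'
  have h : PresentedGroup.mk loopRels (FreeGroup.of LoopGen.sigma₁ * FreeGroup.of LoopGen.sigma₂ *
      FreeGroup.of LoopGen.sigma₁ * (FreeGroup.of LoopGen.sigma₂ *
      FreeGroup.of LoopGen.sigma₁ * FreeGroup.of LoopGen.sigma₂)⁻¹) = 1 :=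
    PresentedGroup.one_of_mem (Or.inl rfl)
  simpa [inclGen, PresentedGroup.of] using h

/-- The standard homomorphism `σ₁ ↦ σ₁`, `σ₂ ↦ σ₂` from the braid group to the loop braid group. -/
def incl : B3 →* LB3 := PresentedGroup.toGroup inclGen_rels

/-- The linear action on column vectors of a matrix representation. -/
noncomputable def linearRep {G : Type*} [Group G] {d : ℕ} (ρ : G →* GL (Fin d) ℂ) :
    Representation ℂ G (Fin d → ℂ) :=
  ((Matrix.toLinAlgEquiv' : Matrix (Fin d) (Fin d) ℂ ≃ₐ[ℂ] _) : _ →* _).comp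
    ((Units.coeHom (Matrix (Fin d) (Fin d) ℂ)).comp ρ)

/-- A matrix representation is irreducible: the space is nonzero and the only invariant subspaces
are zero and the whole space. -/
def IsIrred {G : Type*} [Group G] {d : ℕ} (ρ : G →* GL (Fin d) ℂ) : Prop :=
  (linearRep ρ).IsIrreducible

/-- `ρ'` is an extension of `ρ` to the loop braid group, on the same space. -/
def IsExtension {d : ℕ} (ρ : B3 →* GL (Fin d) ℂ) (ρ' : LB3 →* GL (Fin d) ℂ) : Prop :=
  ρ'.comp incl = ρ

/-- `ρ'` is a standard extension of `ρ`: an extension with `ρ'(s₁s₂) = k ρ(σ₁σ₂)` for a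
scalar `k`. -/
def IsStandardExtension {d : ℕ} (ρ : B3 →* GL (Fin d) ℂ) (ρ' : LB3 →* GL (Fin d) ℂ) : Prop :=
  IsExtension ρ ρ' ∧ ∃ k : ℂ,
    (ρ' (PresentedGroup.of LoopGen.s₁ * PresentedGroup.of LoopGen.s₂) :
        Matrix (Fin d) (Fin d) ℂ) =
      k • (ρ (PresentedGroup.of BraidGen.sigma₁ * PresentedGroup.of BraidGen.sigma₂) :
        Matrix (Fin d) (Fin d) ℂ)

/-- The primitive cube root of unity `e^{2πi/3}`. -/
noncomputable def om : ℂ := Complex.exp (2 * Real.pi * Complex.I / 3)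

/-- The image of `σ₁` in the six dimensional example. -/
noncomputable def exA : Matrix (Fin 6) (Fin 6) ℂ :=
  !![1, -om + 1, -om ^ 2 + 1, om - 1, om ^ 2 - 1, om - 1;
    om ^ 2 - 1, om ^ 2, 0, -om ^ 2 + 1, 0, 0;
    om ^ 2 - 1, om ^ 2 - 1, om ^ 2, -om ^ 2 + 1, -om ^ 2 + 1, 0;
    0, om - 1, om ^ 2 - 1, -om, -om ^ 2 + 1, -om + 1;
    -om ^ 2 + 1, -om ^ 2 + 1, 0, om ^ 2 - 1, -1, 0;
    -om ^ 2 + 1, -om ^ 2 + 1, -om ^ 2 + 1, om ^ 2 - 1, om ^ 2 - 1, -1]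

/-- The image of `σ₂` in the six dimensional example. -/
noncomputable def exB : Matrix (Fin 6) (Fin 6) ℂ :=
  !![1, -om + 1, -om ^ 2 + 1, -om + 1, -om ^ 2 + 1, -om + 1;
    om ^ 2 - 1, om ^ 2, 0, om ^ 2 - 1, 0, 0;
    om ^ 2 - 1, om ^ 2 - 1, om ^ 2, om ^ 2 - 1, om ^ 2 - 1, 0;
    0, -om + 1, -om ^ 2 + 1, -om, -om ^ 2 + 1, -om + 1;
    om ^ 2 - 1, om ^ 2 - 1, 0, om ^ 2 - 1, -1, 0;
    om ^ 2 - 1, om ^ 2 - 1, om ^ 2 - 1, om ^ 2 - 1, om ^ 2 - 1, -1]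

end LoopBraid

/-! Both parts turn on one matrix. In the loop braid group `s₁s₂` has order three, is inverted by
the involution `s₁`, and conjugates `σ₁` to `σ₂`, just as `σ₁σ₂` does.

Positive part: in an irreducible representation the central element `(σ₁σ₂)³ = (σ₁σ₂σ₁)²` is a
scalar, so a multiple P of `σ₁σ₂` has order three and a multiple Q of the half twist has order two.
For dimension d > 1 an eigenspace of P meets each eigenspace of Q trivially, since a common
eigenvector would span an invariant line. Hence every eigenspace of P has dimension at most d/2
(`two_mul_finrank_cubeProj_le`). Three distinct natural numbers, each at most half of their sum,
have sum at least 3 + 2 + 1 = 6. So for d ≤ 5 two eigenvalues of P have equal multiplicity. After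
multiplying P by a cube root of unity these are ω and ω², and an involution S exchanging their
eigenspaces inverts P (`exists_involution`). Then s₁ = S, s₂ = P²S is a standard extension
(`exists_extension`).

Negative part: in the example X = ABA satisfies X² = 1, and the multiplicities of AB are 3, 2, 1.
For any extension put P = ρ'(s₁s₂) and M = XP. Then M commutes with A, and MXM = XP² commutes with
B. The commutant of A has an explicit basis of six elements (`eq_sum_of_commute`), so the second
condition is a system of quadrics in six coefficients. The quadrics force P to be a multiple of XA
or of XA⁻¹ = AB (`coefficients_of_commute`), and the traces of these contradict tr P = tr P⁻¹
(`false_of_smul`). -/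

namespace LoopBraid

/-! ### Homomorphisms out of the two presented groups, and the extension criterion. -/

section Presentations

variable {G : Type*} [Group G]

/-- The homomorphism from the braid group given by two elements satisfying the braid relation. -/
def braidLift (a b : G) (h : a * b * a = b * a * b) : B3 →* G :=
  PresentedGroup.toGroup (f := fun x => match x with | .sigma₁ => a | .sigma₂ => b) (by
    intro r hr
    have hr' : r = FreeGroup.of BraidGen.sigma₁ * FreeGroup.of BraidGen.sigma₂ *
        FreeGroup.of BraidGen.sigma₁ * (FreeGroup.of BraidGen.sigma₂ *
        FreeGroup.of BraidGen.sigma₁ * FreeGroup.of BraidGen.sigma₂)⁻¹ := hr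
    subst hr'
    rw [map_mul, map_inv, mul_inv_eq_one]
    simpa using h)

theorem braidLift_sigma₁ (a b : G) (h : a * b * a = b * a * b) :
    braidLift a b h (PresentedGroup.of BraidGen.sigma₁) = a :=
  PresentedGroup.toGroup.of _

theorem braidLift_sigma₂ (a b : G) (h : a * b * a = b * a * b) :
    braidLift a b h (PresentedGroup.of BraidGen.sigma₂) = b :=
  PresentedGroup.toGroup.of _

/-- The homomorphism from the loop braid group given by four elements satisfying the defining
relations. -/
def loopLift (a b s t : G) (hab : a * b * a = b * a * b) (hst : s * t * s = t * s * t)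
    (hs : s ^ 2 = 1) (ht : t ^ 2 = 1) (hsta : s * t * a = b * s * t)
    (habs : a * b * s = t * a * b) : LB3 →* G :=
  PresentedGroup.toGroup
    (f := fun x => match x with | .sigma₁ => a | .sigma₂ => b | .s₁ => s | .s₂ => t) (by
    rintro r (rfl | rfl | rfl | rfl | rfl | rfl)
    · rw [map_mul, map_inv, mul_inv_eq_one]; simpa using hab
    · rw [map_mul, map_inv, mul_inv_eq_one]; simpa using hst
    · simpa using hs
    · simpa using ht
    · rw [map_mul, map_inv, mul_inv_eq_one]; simpa using hsta
    · rw [map_mul, map_inv, mul_inv_eq_one]; simpa using habs)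

theorem loopLift_sigma₁ {a b s t : G} (hab : a * b * a = b * a * b) (hst : s * t * s = t * s * t)
    (hs : s ^ 2 = 1) (ht : t ^ 2 = 1) (hsta : s * t * a = b * s * t)
    (habs : a * b * s = t * a * b) :
    loopLift a b s t hab hst hs ht hsta habs (PresentedGroup.of LoopGen.sigma₁) = a :=
  PresentedGroup.toGroup.of _

theorem loopLift_sigma₂ {a b s t : G} (hab : a * b * a = b * a * b) (hst : s * t * s = t * s * t)
    (hs : s ^ 2 = 1) (ht : t ^ 2 = 1) (hsta : s * t * a = b * s * t)
    (habs : a * b * s = t * a * b) :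
    loopLift a b s t hab hst hs ht hsta habs (PresentedGroup.of LoopGen.sigma₂) = b :=
  PresentedGroup.toGroup.of _

theorem loopLift_s₁ {a b s t : G} (hab : a * b * a = b * a * b) (hst : s * t * s = t * s * t)
    (hs : s ^ 2 = 1) (ht : t ^ 2 = 1) (hsta : s * t * a = b * s * t)
    (habs : a * b * s = t * a * b) :
    loopLift a b s t hab hst hs ht hsta habs (PresentedGroup.of LoopGen.s₁) = s :=
  PresentedGroup.toGroup.of _

theorem loopLift_s₂ {a b s t : G} (hab : a * b * a = b * a * b) (hst : s * t * s = t * s * t)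
    (hs : s ^ 2 = 1) (ht : t ^ 2 = 1) (hsta : s * t * a = b * s * t)
    (habs : a * b * s = t * a * b) :
    loopLift a b s t hab hst hs ht hsta habs (PresentedGroup.of LoopGen.s₂) = t :=
  PresentedGroup.toGroup.of _

theorem incl_sigma₁ :
    incl (PresentedGroup.of BraidGen.sigma₁) = PresentedGroup.of LoopGen.sigma₁ :=
  PresentedGroup.toGroup.of _

theorem incl_sigma₂ :
    incl (PresentedGroup.of BraidGen.sigma₂) = PresentedGroup.of LoopGen.sigma₂ :=
  PresentedGroup.toGroup.of _

theorem braid_relation :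
    (PresentedGroup.of BraidGen.sigma₁ * PresentedGroup.of BraidGen.sigma₂ * PresentedGroup.of BraidGen.sigma₁ : B3) =
      PresentedGroup.of BraidGen.sigma₂ * PresentedGroup.of BraidGen.sigma₁ * PresentedGroup.of BraidGen.sigma₂ :=
  PresentedGroup.mk_eq_mk_of_mul_inv_mem (rels := braidRels) rfl

theorem loop_relations :
    (PresentedGroup.of LoopGen.s₁ * PresentedGroup.of LoopGen.s₂ * PresentedGroup.of LoopGen.s₁ : LB3) =
        PresentedGroup.of LoopGen.s₂ * PresentedGroup.of LoopGen.s₁ * PresentedGroup.of LoopGen.s₂ ∧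
      (PresentedGroup.of LoopGen.s₁ ^ 2 : LB3) = 1 ∧ (PresentedGroup.of LoopGen.s₂ ^ 2 : LB3) = 1 ∧
      (PresentedGroup.of LoopGen.s₁ * PresentedGroup.of LoopGen.s₂ * PresentedGroup.of LoopGen.sigma₁ : LB3) =
        PresentedGroup.of LoopGen.sigma₂ * PresentedGroup.of LoopGen.s₁ * PresentedGroup.of LoopGen.s₂ := by
  refine ⟨?_, ?_, ?_, ?_⟩
  · exact PresentedGroup.mk_eq_mk_of_mul_inv_mem (rels := loopRels) (Or.inr (Or.inl rfl))
  · exact PresentedGroup.one_of_mem (rels := loopRels) (Or.inr (Or.inr (Or.inl rfl)))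
  · exact PresentedGroup.one_of_mem (rels := loopRels) (Or.inr (Or.inr (Or.inr (Or.inl rfl))))
  · exact PresentedGroup.mk_eq_mk_of_mul_inv_mem (rels := loopRels)
      (Or.inr (Or.inr (Or.inr (Or.inr (Or.inl rfl)))))

/-- A property of elements of the braid group which is closed under products and inverses holds
for all elements as soon as it holds for the two generators. -/
theorem braid_induction {C : B3 → Prop} (h₁ : C (PresentedGroup.of BraidGen.sigma₁))
    (h₂ : C (PresentedGroup.of BraidGen.sigma₂)) (one : C 1) (mul : ∀ g h, C g → C h → C (g * h))
    (inv : ∀ g, C g → C g⁻¹) (g : B3) : C g := by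
  have hg : g ∈ Subgroup.closure (Set.range (PresentedGroup.of : BraidGen → B3)) := by
    rw [PresentedGroup.closure_range_of]; trivial
  induction hg using Subgroup.closure_induction with
  | mem x hx =>
    obtain ⟨i, rfl⟩ := hx
    cases i
    exacts [h₁, h₂]
  | one => exact one
  | mul x y _ _ hx hy => exact mul x y hx hy
  | inv x _ hx => exact inv x hx

/-- An involution inverting a multiple of order three of `ρ(σ₁σ₂)` by a central element gives an
extension to the loop braid group. -/
theorem exists_extension (ρ : B3 →* G) (z s : G) (hz : ∀ g, z * ρ g = ρ g * z)
    (hp : (z * ρ (PresentedGroup.of BraidGen.sigma₁ * PresentedGroup.of BraidGen.sigma₂)) ^ 3 = 1)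
    (hzs : z * s = s * z) (hs : s ^ 2 = 1)
    (hsp : s * (z * ρ (PresentedGroup.of BraidGen.sigma₁ * PresentedGroup.of BraidGen.sigma₂)) * s =
      (z * ρ (PresentedGroup.of BraidGen.sigma₁ * PresentedGroup.of BraidGen.sigma₂)) ^ 2) :
    ∃ ρ' : LB3 →* G, ρ'.comp incl = ρ ∧
      ρ' (PresentedGroup.of LoopGen.s₁ * PresentedGroup.of LoopGen.s₂) =
        z * ρ (PresentedGroup.of BraidGen.sigma₁ * PresentedGroup.of BraidGen.sigma₂) := by
  set a := ρ (PresentedGroup.of BraidGen.sigma₁) with ha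
  set b := ρ (PresentedGroup.of BraidGen.sigma₂) with hb
  have hab : a * b * a = b * a * b := by
    simpa only [map_mul] using congrArg ρ braid_relation
  have hρ : ρ (PresentedGroup.of BraidGen.sigma₁ * PresentedGroup.of BraidGen.sigma₂) = a * b :=
    map_mul ρ _ _
  rw [hρ] at hp hsp
  set p := z * (a * b) with hpdef
  have hss : s * s = 1 := by rw [← pow_two, hs]
  have hsp' : s * p = p ^ 2 * s := by rw [← hsp, mul_assoc, hss, mul_one]
  have hp3 : p ^ 2 * p = 1 := by rw [← pow_succ, hp]
  have hp3' : p * p ^ 2 = 1 := by rw [← pow_succ', hp]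
  have hp4 : p ^ 2 * p ^ 2 = p := by rw [pow_two, mul_assoc, ← pow_two, hp3', mul_one]
  have hst : s * (p ^ 2 * s) = p := by rw [← hsp', ← mul_assoc, hss, one_mul]
  have hts : p ^ 2 * s * s = p ^ 2 := by rw [mul_assoc, hss, mul_one]
  -- The choice t = p²s is forced by st = p, because s inverts p. The mixed relation with `s₁s₂`
  -- then reduces to the braid relation, since p is a central multiple of ab.
  refine ⟨loopLift a b s (p ^ 2 * s) hab ?_ hs ?_ ?_ ?_, ?_, ?_⟩
  · rw [hst, hts, ← mul_assoc, hp4]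
  · rw [pow_two, mul_assoc, hst, hp3]
  · have hzb : z * b = b * z := hz _
    rw [hst, mul_assoc b, hst, hpdef, mul_assoc z, hab, ← mul_assoc b, ← hzb]
    simp only [mul_assoc]
  · have hzp : z * p = p * z := by
      have hzab : z * (a * b) = a * b * z := by rw [ha, hb, ← map_mul]; exact hz _
      rw [hpdef, mul_assoc, ← hzab]
    have hzt : z * (p ^ 2 * s) = p ^ 2 * s * z := by
      have hzp2 : z * p ^ 2 = p ^ 2 * z := (Commute.pow_right hzp 2 : Commute z (p ^ 2))
      rw [← mul_assoc, hzp2, mul_assoc, hzs, mul_assoc]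
    -- Multiplying by z turns ab into p, and the relation becomes ps = p²sp.
    apply mul_left_cancel (a := z)
    calc z * (a * b * s) = p * s := by rw [hpdef]; simp only [mul_assoc]
      _ = p ^ 2 * s * p := by
        rw [mul_assoc (p ^ 2), hsp', ← mul_assoc, hp4]
      _ = z * (p ^ 2 * s * a * b) := by
        rw [hpdef, ← hpdef, ← mul_assoc, ← hzt]; simp only [mul_assoc]
  · refine PresentedGroup.ext fun x => ?_
    cases x
    · rw [MonoidHom.comp_apply, incl_sigma₁, loopLift_sigma₁]
    · rw [MonoidHom.comp_apply, incl_sigma₂, loopLift_sigma₂]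
  · rw [map_mul, loopLift_s₁, loopLift_s₂, hst, hpdef, hρ]

end Presentations

/-! ### Explicit matrices over the Eisenstein integers. -/

/-- The ring `ℤ[ω]` of Eisenstein integers, in a form in which identities between explicit
matrices can be decided. -/
abbrev Eis : Type := QuadraticAlgebra ℤ (-1) (-1)

theorem om_sq : om ^ 2 = -1 - om := by
  have h : IsPrimitiveRoot om 3 := by
    have := Complex.isPrimitiveRoot_exp 3 (by norm_num)
    simpa [om] using this
  have h3 : om ^ 3 = 1 := h.pow_eq_one
  have h1 : om - 1 ≠ 0 := sub_ne_zero.mpr (h.ne_one (by norm_num))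
  have : (om - 1) * (om ^ 2 + om + 1) = 0 := by linear_combination h3
  have := (mul_eq_zero.mp this).resolve_left h1
  linear_combination this

/-- The embedding of the Eisenstein integers into `ℂ` which maps `ω` to `e^{2πi/3}`. -/
noncomputable def eisHom : Eis →+* ℂ :=
  (QuadraticAlgebra.lift (R := ℤ) (a := -1) (b := -1)
    ⟨om, by simp only [neg_smul, one_smul]; linear_combination om_sq⟩ :
    Eis →ₐ[ℤ] ℂ)

@[simp] theorem eisHom_mk (a b : ℤ) : eisHom ⟨a, b⟩ = a + b * om := by
  simp [eisHom, QuadraticAlgebra.lift]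

/-- An Eisenstein integer matrix, considered as a complex matrix. -/
noncomputable abbrev toC {m n : Type*} (M : Matrix m n Eis) : Matrix m n ℂ := M.map eisHom

/-- The matrix `exA` over the Eisenstein integers. -/
def eA : Matrix (Fin 6) (Fin 6) Eis :=
  !![⟨1, 0⟩, ⟨1, -1⟩, ⟨2, 1⟩, ⟨-1, 1⟩, ⟨-2, -1⟩, ⟨-1, 1⟩;
    ⟨-2, -1⟩, ⟨-1, -1⟩, ⟨0, 0⟩, ⟨2, 1⟩, ⟨0, 0⟩, ⟨0, 0⟩;
    ⟨-2, -1⟩, ⟨-2, -1⟩, ⟨-1, -1⟩, ⟨2, 1⟩, ⟨2, 1⟩, ⟨0, 0⟩;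
    ⟨0, 0⟩, ⟨-1, 1⟩, ⟨-2, -1⟩, ⟨0, -1⟩, ⟨2, 1⟩, ⟨1, -1⟩;
    ⟨2, 1⟩, ⟨2, 1⟩, ⟨0, 0⟩, ⟨-2, -1⟩, ⟨-1, 0⟩, ⟨0, 0⟩;
    ⟨2, 1⟩, ⟨2, 1⟩, ⟨2, 1⟩, ⟨-2, -1⟩, ⟨-2, -1⟩, ⟨-1, 0⟩]

/-- The matrix `exB` over the Eisenstein integers. -/
def eB : Matrix (Fin 6) (Fin 6) Eis :=
  !![⟨1, 0⟩, ⟨1, -1⟩, ⟨2, 1⟩, ⟨1, -1⟩, ⟨2, 1⟩, ⟨1, -1⟩;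
    ⟨-2, -1⟩, ⟨-1, -1⟩, ⟨0, 0⟩, ⟨-2, -1⟩, ⟨0, 0⟩, ⟨0, 0⟩;
    ⟨-2, -1⟩, ⟨-2, -1⟩, ⟨-1, -1⟩, ⟨-2, -1⟩, ⟨-2, -1⟩, ⟨0, 0⟩;
    ⟨0, 0⟩, ⟨1, -1⟩, ⟨2, 1⟩, ⟨0, -1⟩, ⟨2, 1⟩, ⟨1, -1⟩;
    ⟨-2, -1⟩, ⟨-2, -1⟩, ⟨0, 0⟩, ⟨-2, -1⟩, ⟨-1, 0⟩, ⟨0, 0⟩;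
    ⟨-2, -1⟩, ⟨-2, -1⟩, ⟨-2, -1⟩, ⟨-2, -1⟩, ⟨-2, -1⟩, ⟨-1, 0⟩]

/-- The inverse of `eA`. -/
def eAinv : Matrix (Fin 6) (Fin 6) Eis :=
  !![⟨1, 0⟩, ⟨2, 1⟩, ⟨1, -1⟩, ⟨2, 1⟩, ⟨1, -1⟩, ⟨2, 1⟩;
    ⟨-1, 1⟩, ⟨0, 1⟩, ⟨0, 0⟩, ⟨-1, 1⟩, ⟨0, 0⟩, ⟨0, 0⟩;
    ⟨-1, 1⟩, ⟨-1, 1⟩, ⟨0, 1⟩, ⟨-1, 1⟩, ⟨-1, 1⟩, ⟨0, 0⟩;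
    ⟨0, 0⟩, ⟨2, 1⟩, ⟨1, -1⟩, ⟨1, 1⟩, ⟨1, -1⟩, ⟨2, 1⟩;
    ⟨-1, 1⟩, ⟨-1, 1⟩, ⟨0, 0⟩, ⟨-1, 1⟩, ⟨-1, 0⟩, ⟨0, 0⟩;
    ⟨-1, 1⟩, ⟨-1, 1⟩, ⟨-1, 1⟩, ⟨-1, 1⟩, ⟨-1, 1⟩, ⟨-1, 0⟩]

/-- The inverse of `eB`. -/
def eBinv : Matrix (Fin 6) (Fin 6) Eis :=
  !![⟨1, 0⟩, ⟨2, 1⟩, ⟨1, -1⟩, ⟨-2, -1⟩, ⟨-1, 1⟩, ⟨-2, -1⟩;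
    ⟨-1, 1⟩, ⟨0, 1⟩, ⟨0, 0⟩, ⟨1, -1⟩, ⟨0, 0⟩, ⟨0, 0⟩;
    ⟨-1, 1⟩, ⟨-1, 1⟩, ⟨0, 1⟩, ⟨1, -1⟩, ⟨1, -1⟩, ⟨0, 0⟩;
    ⟨0, 0⟩, ⟨-2, -1⟩, ⟨-1, 1⟩, ⟨1, 1⟩, ⟨1, -1⟩, ⟨2, 1⟩;
    ⟨1, -1⟩, ⟨1, -1⟩, ⟨0, 0⟩, ⟨-1, 1⟩, ⟨-1, 0⟩, ⟨0, 0⟩;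
    ⟨1, -1⟩, ⟨1, -1⟩, ⟨1, -1⟩, ⟨-1, 1⟩, ⟨-1, 1⟩, ⟨-1, 0⟩]

/-- The square of `eA`. -/
def eA2 : Matrix (Fin 6) (Fin 6) Eis :=
  !![⟨-11, -6⟩, ⟨-10, -11⟩, ⟨1, -1⟩, ⟨12, 9⟩, ⟨3, 3⟩, ⟨0, 3⟩;
    ⟨-1, 1⟩, ⟨-6, 1⟩, ⟨-6, -6⟩, ⟨3, -3⟩, ⟨6, 6⟩, ⟨6, 0⟩;
    ⟨5, 7⟩, ⟨-1, 7⟩, ⟨-6, -5⟩, ⟨-3, -9⟩, ⟨3, 3⟩, ⟨6, 0⟩;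
    ⟨12, 6⟩, ⟨12, 9⟩, ⟨3, 3⟩, ⟨-13, -7⟩, ⟨-7, -5⟩, ⟨-2, -1⟩;
    ⟨-3, -3⟩, ⟨3, -3⟩, ⟨6, 6⟩, ⟨1, 5⟩, ⟨-5, -6⟩, ⟨-6, 0⟩;
    ⟨-9, -9⟩, ⟨-3, -9⟩, ⟨3, 3⟩, ⟨7, 11⟩, ⟨1, -1⟩, ⟨-5, 0⟩]

/-- The cube of `eA`. -/
def eA3 : Matrix (Fin 6) (Fin 6) Eis :=
  !![⟨-5, 24⟩, ⟨-42, 12⟩, ⟨-36, -36⟩, ⟨20, -32⟩, ⟨34, 32⟩, ⟨38, 4⟩;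
    ⟨36, 36⟩, ⟨31, 48⟩, ⟨0, 12⟩, ⟨-40, -44⟩, ⟨-12, -24⟩, ⟨-6, -12⟩;
    ⟨36, 24⟩, ⟨54, 48⟩, ⟨13, 36⟩, ⟨-52, -32⟩, ⟨-22, -44⟩, ⟨-30, -24⟩;
    ⟨-18, -36⟩, ⟨20, -32⟩, ⟨34, 32⟩, ⟨5, 48⟩, ⟨-24, -24⟩, ⟨-36, 0⟩;
    ⟨-34, -32⟩, ⟨-40, -44⟩, ⟨-12, -24⟩, ⟨42, 36⟩, ⟨23, 36⟩, ⟨18, 12⟩;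
    ⟨-22, -8⟩, ⟨-52, -32⟩, ⟨-22, -44⟩, ⟨42, 12⟩, ⟨24, 48⟩, ⟨41, 24⟩]

/-- The square of the inverse of `eA`. -/
def eAinv2 : Matrix (Fin 6) (Fin 6) Eis :=
  !![⟨-5, 6⟩, ⟨1, 11⟩, ⟨2, 1⟩, ⟨-3, 9⟩, ⟨0, 3⟩, ⟨3, 3⟩;
    ⟨-2, -1⟩, ⟨-7, -1⟩, ⟨0, 6⟩, ⟨-6, -3⟩, ⟨0, 6⟩, ⟨-6, 0⟩;
    ⟨-2, -7⟩, ⟨-8, -7⟩, ⟨-1, 5⟩, ⟨-6, -9⟩, ⟨0, 3⟩, ⟨-6, 0⟩;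
    ⟨-6, 6⟩, ⟨-3, 9⟩, ⟨0, 3⟩, ⟨-6, 7⟩, ⟨-2, 5⟩, ⟨-1, 1⟩;
    ⟨0, -3⟩, ⟨-6, -3⟩, ⟨0, 6⟩, ⟨-4, -5⟩, ⟨1, 6⟩, ⟨-6, 0⟩;
    ⟨0, -9⟩, ⟨-6, -9⟩, ⟨0, 3⟩, ⟨-4, -11⟩, ⟨2, 1⟩, ⟨-5, 0⟩]

/-- The image `eA * eB * eA` of the half twist. -/
def eX : Matrix (Fin 6) (Fin 6) Eis :=
  !![⟨1, 0⟩, ⟨0, 0⟩, ⟨0, 0⟩, ⟨0, 0⟩, ⟨0, 0⟩, ⟨0, 0⟩;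
    ⟨0, 0⟩, ⟨1, 0⟩, ⟨0, 0⟩, ⟨0, 0⟩, ⟨0, 0⟩, ⟨0, 0⟩;
    ⟨0, 0⟩, ⟨0, 0⟩, ⟨1, 0⟩, ⟨0, 0⟩, ⟨0, 0⟩, ⟨0, 0⟩;
    ⟨0, 0⟩, ⟨0, 0⟩, ⟨0, 0⟩, ⟨-1, 0⟩, ⟨0, 0⟩, ⟨0, 0⟩;
    ⟨0, 0⟩, ⟨0, 0⟩, ⟨0, 0⟩, ⟨0, 0⟩, ⟨-1, 0⟩, ⟨0, 0⟩;
    ⟨0, 0⟩, ⟨0, 0⟩, ⟨0, 0⟩, ⟨0, 0⟩, ⟨0, 0⟩, ⟨-1, 0⟩]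

/-- The image `eA * eB` of the element of order three in the quotient by the centre. -/
def eY : Matrix (Fin 6) (Fin 6) Eis :=
  !![⟨1, 0⟩, ⟨2, 1⟩, ⟨1, -1⟩, ⟨2, 1⟩, ⟨1, -1⟩, ⟨2, 1⟩;
    ⟨-1, 1⟩, ⟨0, 1⟩, ⟨0, 0⟩, ⟨-1, 1⟩, ⟨0, 0⟩, ⟨0, 0⟩;
    ⟨-1, 1⟩, ⟨-1, 1⟩, ⟨0, 1⟩, ⟨-1, 1⟩, ⟨-1, 1⟩, ⟨0, 0⟩;
    ⟨0, 0⟩, ⟨-2, -1⟩, ⟨-1, 1⟩, ⟨-1, -1⟩, ⟨-1, 1⟩, ⟨-2, -1⟩;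
    ⟨1, -1⟩, ⟨1, -1⟩, ⟨0, 0⟩, ⟨1, -1⟩, ⟨1, 0⟩, ⟨0, 0⟩;
    ⟨1, -1⟩, ⟨1, -1⟩, ⟨1, -1⟩, ⟨1, -1⟩, ⟨1, -1⟩, ⟨1, 0⟩]

/-- An eigenvector of `eY` for the eigenvalue `ω²`, as a column. -/
def eU : Matrix (Fin 6) (Fin 1) Eis :=
  !![⟨1, 0⟩;
    ⟨0, 0⟩;
    ⟨0, 0⟩;
    ⟨-1, 0⟩;
    ⟨0, 0⟩;
    ⟨0, 0⟩]

/-- A left eigenvector of `eY` for the eigenvalue `ω²`, as a row. -/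
def eL : Matrix (Fin 1) (Fin 6) Eis :=
  !![⟨0, 0⟩, ⟨1, 0⟩, ⟨0, 0⟩, ⟨1, 0⟩, ⟨0, 0⟩, ⟨1, 0⟩]

/-- Six elements of the algebra generated by `eA` and its inverse, forming a basis of the
commutant of `eA`. -/
def eF : Fin 6 → Matrix (Fin 6) (Fin 6) Eis := ![eA, eAinv, 1, eA2, eAinv2, eA3]

/-- The columns are the vectors `eF k * eU`. -/
def eK : Matrix (Fin 6) (Fin 6) Eis :=
  !![⟨2, -1⟩, ⟨-1, -1⟩, ⟨1, 0⟩, ⟨-23, -15⟩, ⟨-2, -3⟩, ⟨-25, 56⟩;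
    ⟨-4, -2⟩, ⟨0, 0⟩, ⟨0, 0⟩, ⟨-4, 4⟩, ⟨4, 2⟩, ⟨76, 80⟩;
    ⟨-4, -2⟩, ⟨0, 0⟩, ⟨0, 0⟩, ⟨8, 16⟩, ⟨4, 2⟩, ⟨88, 56⟩;
    ⟨0, 1⟩, ⟨-1, -1⟩, ⟨-1, 0⟩, ⟨25, 13⟩, ⟨0, -1⟩, ⟨-23, -84⟩;
    ⟨4, 2⟩, ⟨0, 0⟩, ⟨0, 0⟩, ⟨-4, -8⟩, ⟨4, 2⟩, ⟨-76, -68⟩;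
    ⟨4, 2⟩, ⟨0, 0⟩, ⟨0, 0⟩, ⟨-16, -20⟩, ⟨4, 2⟩, ⟨-64, -20⟩]

/-- The inverse of `eK`, up to a factor. -/
def eKadj : Matrix (Fin 6) (Fin 6) Eis :=
  !![⟨0, 0⟩, ⟨-19, 8⟩, ⟨17, -6⟩, ⟨0, 0⟩, ⟨-11, 6⟩, ⟨13, -8⟩;
    ⟨0, 12⟩, ⟨1, 9⟩, ⟨-5, -5⟩, ⟨0, 12⟩, ⟨-7, -1⟩, ⟨-1, -3⟩;
    ⟨12, 0⟩, ⟨-4, 5⟩, ⟨8, -9⟩, ⟨-12, 0⟩, ⟨20, -3⟩, ⟨-16, 11⟩;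
    ⟨0, 0⟩, ⟨-3, 1⟩, ⟨3, -1⟩, ⟨0, 0⟩, ⟨-3, -1⟩, ⟨3, 1⟩;
    ⟨0, 0⟩, ⟨1, 0⟩, ⟨1, -2⟩, ⟨0, 0⟩, ⟨1, -2⟩, ⟨1, 0⟩;
    ⟨0, 0⟩, ⟨0, 1⟩, ⟨0, -1⟩, ⟨0, 0⟩, ⟨0, 1⟩, ⟨0, -1⟩]

/-- The rows are the vectors `eL * eF k`. -/
def eR : Matrix (Fin 6) (Fin 6) Eis :=
  !![⟨0, 0⟩, ⟨0, 1⟩, ⟨0, 0⟩, ⟨0, -1⟩, ⟨0, 0⟩, ⟨0, -1⟩;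
    ⟨-2, 2⟩, ⟨1, 3⟩, ⟨0, 0⟩, ⟨-1, 3⟩, ⟨0, 0⟩, ⟨1, 1⟩;
    ⟨0, 0⟩, ⟨1, 0⟩, ⟨0, 0⟩, ⟨1, 0⟩, ⟨0, 0⟩, ⟨1, 0⟩;
    ⟨2, -2⟩, ⟨3, 1⟩, ⟨0, 0⟩, ⟨-3, 1⟩, ⟨0, 0⟩, ⟨-1, -1⟩;
    ⟨-8, -4⟩, ⟨-16, -1⟩, ⟨0, 12⟩, ⟨-16, -7⟩, ⟨0, 12⟩, ⟨-12, 1⟩;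
    ⟨-4, -8⟩, ⟨-1, -16⟩, ⟨12, 0⟩, ⟨7, 16⟩, ⟨-12, 0⟩, ⟨-1, 12⟩]

/-- The inverse of `eR`, up to a factor. -/
def eRadj : Matrix (Fin 6) (Fin 6) Eis :=
  !![⟨4, 8⟩, ⟨-4, -2⟩, ⟨-4, 4⟩, ⟨4, 2⟩, ⟨0, 0⟩, ⟨0, 0⟩;
    ⟨-12, -12⟩, ⟨0, 0⟩, ⟨12, 0⟩, ⟨0, 0⟩, ⟨0, 0⟩, ⟨0, 0⟩;
    ⟨11, -1⟩, ⟨0, 1⟩, ⟨-11, -12⟩, ⟨0, 1⟩, ⟨-1, -1⟩, ⟨1, 0⟩;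
    ⟨4, -4⟩, ⟨-4, -2⟩, ⟨4, 8⟩, ⟨-4, -2⟩, ⟨0, 0⟩, ⟨0, 0⟩;
    ⟨-9, -1⟩, ⟨-2, 1⟩, ⟨-9, -8⟩, ⟨-2, -3⟩, ⟨-1, -1⟩, ⟨-1, 0⟩;
    ⟨8, 16⟩, ⟨4, 2⟩, ⟨8, -8⟩, ⟨4, 2⟩, ⟨0, 0⟩, ⟨0, 0⟩]

theorem toC_eA : toC eA = exA := by
  ext i j
  fin_cases i <;> fin_cases j <;> simp [eA, exA, om_sq] <;> ring

theorem toC_eB : toC eB = exB := by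
  ext i j
  fin_cases i <;> fin_cases j <;> simp [eB, exB, om_sq] <;> ring

theorem eA_mul_eB_mul_eA : eA * eB * eA = eX := by decide +kernel
theorem eB_mul_eA_mul_eB : eB * eA * eB = eX := by decide +kernel
theorem eA_mul_eB : eA * eB = eY := by decide +kernel
theorem eX_mul_eX : eX * eX = 1 := by decide +kernel
theorem eA_mul_eAinv : eA * eAinv = 1 := by decide +kernel
theorem eB_mul_eBinv : eB * eBinv = 1 := by decide +kernel
theorem eA_mul_eA : eA * eA = eA2 := by decide +kernel
theorem eA2_mul_eA : eA2 * eA = eA3 := by decide +kernel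
theorem eAinv_mul_eAinv : eAinv * eAinv = eAinv2 := by decide +kernel
theorem eK_mul_eKadj : eK * eKadj = 24 := by decide +kernel
theorem eRadj_mul_eR : eRadj * eR = 24 := by decide +kernel
theorem eF_mul_eU (k i : Fin 6) : (eF k * eU) i 0 = eK i k := by revert k i; decide +kernel
theorem eL_mul_eF (k i : Fin 6) : (eL * eF k) 0 i = eR k i := by
  fin_cases k <;> fin_cases i <;> decide +kernel
-- Up to the factor 3 the left side is the projection onto the ω²-eigenspace of `eY`. It has rank
-- one because that eigenvalue is simple, and this is what drives the irreducibility proof.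
theorem eigenprojection_eY :
    1 + (⟨0, 1⟩ : Eis) • eY + (⟨-1, -1⟩ : Eis) • (eY * eY) = (-3 : Eis) • (eU * eL) := by
  decide +kernel

theorem eAinv_mul_eA : eAinv * eA = 1 := mul_eq_one_comm.mp eA_mul_eAinv

/-! ### Quadratic equations for the coefficients of M. -/

/-- A matrix commuting with B is orthogonal, for the trace form, to every commutator V = BW − WB.
Applied to MXM with M = ∑ mᵢFᵢ, each W yields a quadric in m, with Gram matrix T. -/
theorem quadric_eq_zero {m : Fin 6 → ℂ}
    (h : Commute ((∑ i, m i • toC (eF i)) * toC eX * ∑ i, m i • toC (eF i)) (toC eB))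
    (V W T : Matrix (Fin 6) (Fin 6) Eis) (hV : eB * W - W * eB = V)
    (hT : (Matrix.of fun i j => (V * (eF i * eX * eF j)).trace) = T) :
    ∑ i, ∑ j, m i * m j * eisHom (T i j) = 0 := by
  set K := (∑ i, m i • toC (eF i)) * toC eX * ∑ i, m i • toC (eF i) with hK
  have h1 : (toC V * K).trace = 0 := by
    have hV' : toC V = toC eB * toC W - toC W * toC eB := by
      rw [← hV, ← Matrix.map_mul, ← Matrix.map_mul]
      exact Matrix.map_sub _ (map_sub _) _ _
    rw [hV', sub_mul, Matrix.trace_sub, sub_eq_zero, mul_assoc, Matrix.trace_mul_comm,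
      mul_assoc, h.eq, mul_assoc]
  have h2 : K = ∑ i, ∑ j, (m i * m j) • toC (eF i * eX * eF j) := by
    simp only [hK, Finset.sum_mul, Finset.mul_sum, Matrix.map_mul, smul_mul_assoc, mul_smul_comm]
    rw [Finset.sum_comm]
    refine Finset.sum_congr rfl fun i _ => ?_
    rw [Finset.smul_sum]
    refine Finset.sum_congr rfl fun j _ => ?_
    rw [smul_smul, mul_comm]
  rw [← h1, h2]
  simp only [Finset.mul_sum, Matrix.trace_sum, mul_smul_comm, Matrix.trace_smul, smul_eq_mul,
    ← Matrix.map_mul, ← hT, Matrix.of_apply]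
  refine Finset.sum_congr rfl fun i _ => Finset.sum_congr rfl fun j _ => ?_
  congr 1
  exact AddMonoidHom.map_trace eisHom.toAddMonoidHom _

/-- In this and the next seven lemmas the letters a, …, f stand for `m 0`, …, `m 5`, and the name
gives the leading monomial. Each W is chosen so that, after symmetrising T, the only other monomials
left are among df, ee, ef, ff: the eight quadrics form a reduced echelon system. The explicit V, W,
T are certificates checked by evaluation. -/
theorem quadric_ab {m : Fin 6 → ℂ}
    (h : Commute ((∑ i, m i • toC (eF i)) * toC eX * ∑ i, m i • toC (eF i)) (toC eB)) :
    432 * (m 0 * m 1) + 1296 * (m 3 * m 5) + (6912 - 3024 * om) * (m 4 * m 4) + (-22032 +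
    7776 * om) * (m 4 * m 5) + (432 + 432 * om) * (m 5 * m 5) = 0 := by
  have h0 := quadric_eq_zero h
    !![⟨-18, -18⟩, ⟨-12, -6⟩, ⟨9, 57⟩, ⟨18, 9⟩, ⟨3, -3⟩, ⟨24, 60⟩;
    ⟨0, 0⟩, ⟨18, 18⟩, ⟨0, 0⟩, ⟨0, 0⟩, ⟨0, -15⟩, ⟨6, 0⟩;
    ⟨15, 69⟩, ⟨27, 75⟩, ⟨0, 0⟩, ⟨9, 48⟩, ⟨-3, 60⟩, ⟨-21, -63⟩;
    ⟨-18, -9⟩, ⟨0, 27⟩, ⟨3, 57⟩, ⟨18, 18⟩, ⟨9, 9⟩, ⟨24, 60⟩;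
    ⟨21, 57⟩, ⟨42, 78⟩, ⟨15, 42⟩, ⟨24, 60⟩, ⟨15, 51⟩, ⟨-9, -9⟩;
    ⟨18, 9⟩, ⟨6, 9⟩, ⟨-15, -78⟩, ⟨-18, -18⟩, ⟨-18, -18⟩, ⟨-33, -69⟩]
    !![⟨0, 0⟩, ⟨0, 0⟩, ⟨0, 0⟩, ⟨0, 0⟩, ⟨0, 0⟩, ⟨0, 0⟩;
    ⟨0, 0⟩, ⟨-6, 6⟩, ⟨0, 0⟩, ⟨0, 0⟩, ⟨0, -12⟩, ⟨6, 6⟩;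
    ⟨-15, -6⟩, ⟨0, 0⟩, ⟨16, 35⟩, ⟨9, 0⟩, ⟨0, 0⟩, ⟨0, 0⟩;
    ⟨0, 0⟩, ⟨-6, -12⟩, ⟨6, 6⟩, ⟨0, 0⟩, ⟨3, 12⟩, ⟨0, 0⟩;
    ⟨3, 0⟩, ⟨0, 0⟩, ⟨0, 0⟩, ⟨0, 0⟩, ⟨0, 0⟩, ⟨28, 29⟩;
    ⟨0, 0⟩, ⟨6, 0⟩, ⟨0, 0⟩, ⟨0, 0⟩, ⟨0, 0⟩, ⟨-9, -6⟩]
    !![⟨0, 0⟩, ⟨126, -486⟩, ⟨150, -132⟩, ⟨-282, -150⟩, ⟨2436, 5484⟩, ⟨54, 1008⟩;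
    ⟨306, 486⟩, ⟨0, 0⟩, ⟨132, 282⟩, ⟨2292, -3192⟩, ⟨-282, -150⟩, ⟨-6660, -7902⟩;
    ⟨-150, 132⟩, ⟨-132, -282⟩, ⟨0, 0⟩, ⟨-72, 522⟩, ⟨54, 144⟩, ⟨6564, 2292⟩;
    ⟨282, 150⟩, ⟨-2292, 3192⟩, ⟨72, -522⟩, ⟨0, 0⟩, ⟨1422, -2646⟩, ⟨1272, -498⟩;
    ⟨-2436, -5484⟩, ⟨282, 150⟩, ⟨-54, -144⟩, ⟨-1422, 2646⟩, ⟨6912, -3024⟩, ⟨-57174, 81348⟩;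
    ⟨-54, -1008⟩, ⟨6660, 7902⟩, ⟨-6564, -2292⟩, ⟨24, 498⟩, ⟨35142, -73572⟩, ⟨432, 432⟩]
    (by decide +kernel) (by decide +kernel)
  simp only [Fin.sum_univ_six, Matrix.of_apply, Matrix.cons_val, eisHom_mk] at h0
  push_cast at h0
  linear_combination h0

theorem quadric_ad {m : Fin 6 → ℂ}
    (h : Commute ((∑ i, m i • toC (eF i)) * toC eX * ∑ i, m i • toC (eF i)) (toC eB)) :
    12096 * (m 0 * m 3) + (-387072 - 471744 * om) * (m 3 * m 5) +
    (-107136 - 43200 * om) * (m 4 * m 4) + (183168 + 150336 * om) * (m 4 * m 5) + (-463104 +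
    255744 * om) * (m 5 * m 5) = 0 := by
  have h0 := quadric_eq_zero h
    !![⟨234, 639⟩, ⟨-582, 585⟩, ⟨1044, -144⟩, ⟨-1422, 207⟩, ⟨-486, -261⟩, ⟨-426, -858⟩;
    ⟨0, -336⟩, ⟨-309, -87⟩, ⟨-141, -948⟩, ⟨-924, -693⟩, ⟨-30, -384⟩, ⟨-357, -483⟩;
    ⟨159, -888⟩, ⟨450, -645⟩, ⟨75, -552⟩, ⟨777, -1323⟩, ⟨786, -246⟩, ⟨243, -489⟩;
    ⟨555, 1203⟩, ⟨-237, 1116⟩, ⟨1248, 258⟩, ⟨-1383, 450⟩, ⟨102, 873⟩, ⟨-66, -1101⟩;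
    ⟨795, -30⟩, ⟨618, -813⟩, ⟨1017, -624⟩, ⟨-117, -1485⟩, ⟨1350, -234⟩, ⟨-225, -1515⟩;
    ⟨513, -582⟩, ⟨942, -408⟩, ⟨-39, -516⟩, ⟨1383, -786⟩, ⟨1050, -462⟩, ⟨33, -216⟩]
    !![⟨0, 0⟩, ⟨0, 0⟩, ⟨0, 0⟩, ⟨153, 144⟩, ⟨0, 0⟩, ⟨0, 0⟩;
    ⟨111, 186⟩, ⟨-256, -26⟩, ⟨0, 0⟩, ⟨60, 33⟩, ⟨87, 93⟩, ⟨0, 0⟩;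
    ⟨0, 0⟩, ⟨0, 0⟩, ⟨-111, -480⟩, ⟨-231, 21⟩, ⟨-189, 126⟩, ⟨0, 0⟩;
    ⟨-168, 105⟩, ⟨0, 0⟩, ⟨192, 366⟩, ⟨0, 0⟩, ⟨0, 0⟩, ⟨61, 155⟩;
    ⟨0, 0⟩, ⟨0, 0⟩, ⟨198, 6⟩, ⟨-261, 519⟩, ⟨0, 0⟩, ⟨0, 0⟩;
    ⟨0, 0⟩, ⟨-174, 171⟩, ⟨0, 0⟩, ⟨0, 0⟩, ⟨0, 0⟩, ⟨94, -439⟩]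
    !![⟨0, 0⟩, ⟨378, 23562⟩, ⟨-894, -4362⟩, ⟨9474, 2550⟩, ⟨-21288, 1992⟩, ⟨-31050, -666⟩;
    ⟨-378, -23562⟩, ⟨0, 0⟩, ⟨2328, -2508⟩, ⟨-106824, -23280⟩, ⟨-39810, -35430⟩, ⟨-152604, 405288⟩;
    ⟨894, 4362⟩, ⟨-2328, 2508⟩, ⟨0, 0⟩, ⟨36396, 19728⟩, ⟨-19710, -2934⟩, ⟨-14208, -150312⟩;
    ⟨2622, -2550⟩, ⟨106824, 23280⟩, ⟨-36396, -19728⟩, ⟨0, 0⟩, ⟨539838, 114822⟩, ⟨-163536, -143436⟩;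
    ⟨21288, -1992⟩, ⟨39810, 35430⟩, ⟨19710, 2934⟩, ⟨-539838, -114822⟩, ⟨-107136, -43200⟩, ⟨1417386, 1850766⟩;
    ⟨31050, 666⟩, ⟨152604, -405288⟩, ⟨14208, 150312⟩, ⟨-223536, -328308⟩, ⟨-1234218, -1700430⟩, ⟨-463104, 255744⟩]
    (by decide +kernel) (by decide +kernel)
  simp only [Fin.sum_univ_six, Matrix.of_apply, Matrix.cons_val, eisHom_mk] at h0
  push_cast at h0
  linear_combination h0

theorem quadric_ae {m : Fin 6 → ℂ}
    (h : Commute ((∑ i, m i • toC (eF i)) * toC eX * ∑ i, m i • toC (eF i)) (toC eB)) :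
    864 * (m 0 * m 4) + (864 + 864 * om) * (m 3 * m 5) +
    (-19872 - 13824 * om) * (m 4 * m 5) = 0 := by
  have h0 := quadric_eq_zero h
    !![⟨0, 0⟩, ⟨-3, -12⟩, ⟨3, 6⟩, ⟨0, 18⟩, ⟨0, 0⟩, ⟨0, 6⟩;
    ⟨0, 0⟩, ⟨0, 0⟩, ⟨0, 0⟩, ⟨0, 0⟩, ⟨0, 0⟩, ⟨0, 0⟩;
    ⟨0, -6⟩, ⟨3, 6⟩, ⟨0, 0⟩, ⟨6, 0⟩, ⟨3, 6⟩, ⟨6, 0⟩;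
    ⟨0, 0⟩, ⟨-3, -12⟩, ⟨3, 6⟩, ⟨0, 18⟩, ⟨0, 0⟩, ⟨0, 6⟩;
    ⟨0, -6⟩, ⟨-6, -6⟩, ⟨0, -6⟩, ⟨-6, -6⟩, ⟨6, 0⟩, ⟨-6, -12⟩;
    ⟨0, 0⟩, ⟨-3, 0⟩, ⟨3, -12⟩, ⟨0, -18⟩, ⟨6, -6⟩, ⟨-6, -18⟩]
    !![⟨0, 0⟩, ⟨0, 0⟩, ⟨0, 0⟩, ⟨0, 0⟩, ⟨0, 0⟩, ⟨0, 0⟩;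
    ⟨0, 0⟩, ⟨0, 0⟩, ⟨0, 0⟩, ⟨0, 0⟩, ⟨0, 0⟩, ⟨0, 0⟩;
    ⟨0, -6⟩, ⟨-5, -7⟩, ⟨0, 0⟩, ⟨0, 6⟩, ⟨0, 0⟩, ⟨3, 3⟩;
    ⟨0, 0⟩, ⟨0, 0⟩, ⟨0, 0⟩, ⟨0, 0⟩, ⟨0, 0⟩, ⟨0, 0⟩;
    ⟨0, 6⟩, ⟨0, 0⟩, ⟨3, 3⟩, ⟨0, 0⟩, ⟨0, 0⟩, ⟨-1, 1⟩;
    ⟨0, 0⟩, ⟨0, 0⟩, ⟨0, 0⟩, ⟨0, 6⟩, ⟨0, 0⟩, ⟨0, 0⟩]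
    !![⟨0, 0⟩, ⟨324, 396⟩, ⟨-12, 12⟩, ⟨24, 12⟩, ⟨-336, -672⟩, ⟨-252, 72⟩;
    ⟨-324, -396⟩, ⟨0, 0⟩, ⟨-12, -24⟩, ⟨312, 1416⟩, ⟨-408, -204⟩, ⟨4176, 6588⟩;
    ⟨12, -12⟩, ⟨12, 24⟩, ⟨0, 0⟩, ⟨72, -324⟩, ⟨180, 288⟩, ⟨-1752, -336⟩;
    ⟨-24, -12⟩, ⟨-312, -1416⟩, ⟨-72, 324⟩, ⟨0, 0⟩, ⟨-324, -5436⟩, ⟨876, 1536⟩;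
    ⟨1200, 672⟩, ⟨408, 204⟩, ⟨-180, -288⟩, ⟨324, 5436⟩, ⟨0, 0⟩, ⟨-5604, -27228⟩;
    ⟨252, -72⟩, ⟨-4176, -6588⟩, ⟨1752, 336⟩, ⟨-12, -672⟩, ⟨-14268, 13404⟩, ⟨0, 0⟩]
    (by decide +kernel) (by decide +kernel)
  simp only [Fin.sum_univ_six, Matrix.of_apply, Matrix.cons_val, eisHom_mk] at h0
  push_cast at h0
  linear_combination h0

theorem quadric_cc {m : Fin 6 → ℂ}
    (h : Commute ((∑ i, m i • toC (eF i)) * toC eX * ∑ i, m i • toC (eF i)) (toC eB)) :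
    6048 * (m 2 * m 2) + (-870912 - 508032 * om) * (m 3 * m 5) +
    (-457920 - 55296 * om) * (m 4 * m 4) + (1658880 + 730944 * om) * (m 4 * m 5) + (2760480 +
    3848256 * om) * (m 5 * m 5) = 0 := by
  have h0 := quadric_eq_zero h
    !![⟨-69, -417⟩, ⟨3186, -396⟩, ⟨-4203, -1899⟩, ⟨-1479, -447⟩, ⟨-741, -3483⟩, ⟨2814, 4074⟩;
    ⟨-1512, -1008⟩, ⟨-318, -681⟩, ⟨-501, 870⟩, ⟨894, -1056⟩, ⟨-4371, -975⟩, ⟨2274, 1866⟩;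
    ⟨2151, -162⟩, ⟨-5838, -588⟩, ⟨3411, 1098⟩, ⟨1257, -1437⟩, ⟨-4772, -1408⟩, ⟨-3201, -1770⟩;
    ⟨2433, -219⟩, ⟨5724, 1737⟩, ⟨-5652, -3663⟩, ⟨1401, 822⟩, ⟨-2190, -5247⟩, ⟨1050, 3759⟩;
    ⟨2112, 2262⟩, ⟨47, 3130⟩, ⟨4578, 1491⟩, ⟨1749, 1257⟩, ⟨-3360, -84⟩, ⟨2313, 1899⟩;
    ⟨-4191, -1821⟩, ⟨-5274, -9⟩, ⟨4515, 3234⟩, ⟨-2913, -1830⟩, ⟨-972, 948⟩, ⟨-1065, -738⟩]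
    !![⟨0, 0⟩, ⟨0, 0⟩, ⟨0, 0⟩, ⟨0, 0⟩, ⟨0, 0⟩, ⟨0, 0⟩;
    ⟨-1527, -1242⟩, ⟨108, -222⟩, ⟨0, 0⟩, ⟨0, 0⟩, ⟨0, 0⟩, ⟨-1404, -495⟩;
    ⟨0, 0⟩, ⟨1555, -1264⟩, ⟨0, 0⟩, ⟨531, 270⟩, ⟨-1348, -110⟩, ⟨0, 0⟩;
    ⟨1071, 693⟩, ⟨171, -432⟩, ⟨0, 0⟩, ⟨0, 0⟩, ⟨1905, -60⟩, ⟨0, 0⟩;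
    ⟨0, 0⟩, ⟨245, -749⟩, ⟨-2034, 135⟩, ⟨0, 0⟩, ⟨0, 0⟩, ⟨2791, 869⟩;
    ⟨549, 387⟩, ⟨-1836, -216⟩, ⟨0, 0⟩, ⟨-1098, -1173⟩, ⟨0, 0⟩, ⟨0, 0⟩]
    !![⟨0, 0⟩, ⟨-152052, -152580⟩, ⟨-21522, -2490⟩, ⟨42864, 31656⟩, ⟨689532, -128256⟩, ⟨-84702, 2766⟩;
    ⟨152052, 152580⟩, ⟨0, 0⟩, ⟨7494, -11076⟩, ⟨-667920, -606336⟩, ⟨59928, 74532⟩, ⟨-546666, -1654320⟩;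
    ⟨21522, 2490⟩, ⟨-7494, 11076⟩, ⟨6048, 0⟩, ⟨42942, 142224⟩, ⟨-155226, -4686⟩, ⟨-130776, -511356⟩;
    ⟨-42864, -31656⟩, ⟨667920, 606336⟩, ⟨-42942, -142224⟩, ⟨0, 0⟩, ⟨1032564, 2610744⟩, ⟨-178134, -313356⟩;
    ⟨-689532, 128256⟩, ⟨-59928, -74532⟩, ⟨155226, 4686⟩, ⟨-1032564, -2610744⟩, ⟨-457920, -55296⟩, ⟨14838366, 13954470⟩;
    ⟨84702, -2766⟩, ⟨546666, 1654320⟩, ⟨130776, 511356⟩, ⟨-692778, -194676⟩, ⟨-13179486, -13223526⟩, ⟨2760480, 3848256⟩]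
    (by decide +kernel) (by decide +kernel)
  simp only [Fin.sum_univ_six, Matrix.of_apply, Matrix.cons_val, eisHom_mk] at h0
  push_cast at h0
  linear_combination h0

theorem quadric_cd {m : Fin 6 → ℂ}
    (h : Commute ((∑ i, m i • toC (eF i)) * toC eX * ∑ i, m i • toC (eF i)) (toC eB)) :
    288 * (m 2 * m 3) + (2592 + 1728 * om) * (m 3 * m 5) + (11520 +
    2880 * om) * (m 4 * m 4) + (-20736 - 13824 * om) * (m 4 * m 5) + (4608 +
    10944 * om) * (m 5 * m 5) = 0 := by
  have h0 := quadric_eq_zero h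
    !![⟨8, 4⟩, ⟨16, -1⟩, ⟨2, 49⟩, ⟨0, 0⟩, ⟨2, 64⟩, ⟨-4, -20⟩;
    ⟨0, 24⟩, ⟨0, 0⟩, ⟨0, 0⟩, ⟨0, 24⟩, ⟨0, 0⟩, ⟨-16, 4⟩;
    ⟨-14, 20⟩, ⟨-2, 29⟩, ⟨-8, -4⟩, ⟨-10, 28⟩, ⟨-2, -3⟩, ⟨-20, 8⟩;
    ⟨24, 0⟩, ⟨32, -5⟩, ⟨18, 45⟩, ⟨16, -4⟩, ⟨18, 60⟩, ⟨-4, -20⟩;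
    ⟨-26, 20⟩, ⟨-4, 24⟩, ⟨0, 0⟩, ⟨-26, 20⟩, ⟨0, 0⟩, ⟨-16, 4⟩;
    ⟨-24, 24⟩, ⟨-8, 29⟩, ⟨-2, -49⟩, ⟨-16, 28⟩, ⟨26, -20⟩, ⟨-16, 4⟩]
    !![⟨0, 0⟩, ⟨0, 0⟩, ⟨0, 0⟩, ⟨0, 0⟩, ⟨0, 0⟩, ⟨0, 0⟩;
    ⟨0, 0⟩, ⟨8, 16⟩, ⟨0, 0⟩, ⟨0, 0⟩, ⟨0, 0⟩, ⟨0, 0⟩;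
    ⟨4, 0⟩, ⟨0, 0⟩, ⟨17, 32⟩, ⟨0, 0⟩, ⟨-11, -14⟩, ⟨0, 0⟩;
    ⟨0, 0⟩, ⟨0, 0⟩, ⟨0, 0⟩, ⟨0, 0⟩, ⟨0, 0⟩, ⟨4, -8⟩;
    ⟨0, 0⟩, ⟨-11, -14⟩, ⟨0, 0⟩, ⟨0, 0⟩, ⟨9, 36⟩, ⟨0, 0⟩;
    ⟨0, 0⟩, ⟨0, 0⟩, ⟨0, 0⟩, ⟨0, 0⟩, ⟨4, 24⟩, ⟨0, 0⟩]
    !![⟨0, 0⟩, ⟨-240, 324⟩, ⟨-216, -96⟩, ⟨120, 216⟩, ⟨2088, -2832⟩, ⟨468, 132⟩;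
    ⟨240, -324⟩, ⟨0, 0⟩, ⟨96, -120⟩, ⟨-4488, -792⟩, ⟨120, 216⟩, ⟨636, 12912⟩;
    ⟨216, 96⟩, ⟨-96, 120⟩, ⟨0, 0⟩, ⟨708, -336⟩, ⟨-108, 132⟩, ⟨-6288, -5352⟩;
    ⟨-120, -216⟩, ⟨4488, 792⟩, ⟨-420, 336⟩, ⟨0, 0⟩, ⟨-1104, -5508⟩, ⟨336, 984⟩;
    ⟨-2088, 2832⟩, ⟨-120, -216⟩, ⟨108, -132⟩, ⟨1104, 5508⟩, ⟨11520, 2880⟩, ⟨86544, -2856⟩;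
    ⟨-468, -132⟩, ⟨-636, -12912⟩, ⟨6288, 5352⟩, ⟨2256, 744⟩, ⟨-107280, -10968⟩, ⟨4608, 10944⟩]
    (by decide +kernel) (by decide +kernel)
  simp only [Fin.sum_univ_six, Matrix.of_apply, Matrix.cons_val, eisHom_mk] at h0
  push_cast at h0
  linear_combination h0

theorem quadric_cf {m : Fin 6 → ℂ}
    (h : Commute ((∑ i, m i • toC (eF i)) * toC eX * ∑ i, m i • toC (eF i)) (toC eB)) :
    12096 * (m 2 * m 5) + (-24192 * om) * (m 3 * m 5) +
    (32832 - 131328 * om) * (m 4 * m 4) + (-172800 + 122688 * om) * (m 4 * m 5) + (127872 +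
    177984 * om) * (m 5 * m 5) = 0 := by
  have h0 := quadric_eq_zero h
    !![⟨165, -93⟩, ⟨345, -36⟩, ⟨456, 465⟩, ⟨903, 210⟩, ⟨75, 330⟩, ⟨432, 57⟩;
    ⟨336, 336⟩, ⟨45, 72⟩, ⟨-114, -111⟩, ⟨264, 414⟩, ⟨105, 84⟩, ⟨-111, 3⟩;
    ⟨210, 441⟩, ⟨3, 156⟩, ⟨-210, 21⟩, ⟨114, 426⟩, ⟨27, 186⟩, ⟨-84, -42⟩;
    ⟨6, -87⟩, ⟨294, -21⟩, ⟨453, 351⟩, ⟨708, 255⟩, ⟨198, 342⟩, ⟨318, -54⟩;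
    ⟨261, 321⟩, ⟨111, 81⟩, ⟨-93, -27⟩, ⟨180, 351⟩, ⟨18, -72⟩, ⟨-24, 33⟩;
    ⟨450, 321⟩, ⟨-507, -51⟩, ⟨-711, -915⟩, ⟨-372, 81⟩, ⟨-306, -624⟩, ⟨-726, -183⟩]
    !![⟨0, 0⟩, ⟨0, 0⟩, ⟨0, 0⟩, ⟨72, -15⟩, ⟨-63, -63⟩, ⟨0, 0⟩;
    ⟨0, 0⟩, ⟨260, 178⟩, ⟨75, -6⟩, ⟨75, 36⟩, ⟨0, 0⟩, ⟨0, 0⟩;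
    ⟨0, 0⟩, ⟨0, 0⟩, ⟨439, 344⟩, ⟨42, 42⟩, ⟨-84, -63⟩, ⟨0, 0⟩;
    ⟨111, 60⟩, ⟨0, 0⟩, ⟨0, 0⟩, ⟨0, 0⟩, ⟨0, 0⟩, ⟨0, 0⟩;
    ⟨27, -3⟩, ⟨0, 0⟩, ⟨-54, -120⟩, ⟨0, 0⟩, ⟨375, 285⟩, ⟨0, 0⟩;
    ⟨0, 0⟩, ⟨54, -27⟩, ⟨0, 0⟩, ⟨423, 303⟩, ⟨0, 0⟩, ⟨341, 148⟩]
    !![⟨0, 0⟩, ⟨14022, 7794⟩, ⟨-192, -618⟩, ⟨78, -186⟩, ⟨-18336, 11100⟩, ⟨4644, 3726⟩;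
    ⟨-14022, -7794⟩, ⟨0, 0⟩, ⟨-498, -150⟩, ⟨32316, 33024⟩, ⟨-1830, 15006⟩, ⟨192258, 175590⟩;
    ⟨192, 618⟩, ⟨498, 150⟩, ⟨0, 0⟩, ⟨-10314, -15066⟩, ⟨17352, 8082⟩, ⟨-12480, 27492⟩;
    ⟨-78, 186⟩, ⟨-32316, -33024⟩, ⟨10314, 15066⟩, ⟨0, 0⟩, ⟨-215550, -197334⟩, ⟨35454, 13038⟩;
    ⟨18336, -11100⟩, ⟨1830, -15006⟩, ⟨-17352, -8082⟩, ⟨215550, 197334⟩, ⟨32832, -131328⟩, ⟨-846060, -730794⟩;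
    ⟨-4644, -3726⟩, ⟨-192258, -175590⟩, ⟨24576, -27492⟩, ⟨-35454, -37230⟩, ⟨673260, 853482⟩, ⟨127872, 177984⟩]
    (by decide +kernel) (by decide +kernel)
  simp only [Fin.sum_univ_six, Matrix.of_apply, Matrix.cons_val, eisHom_mk] at h0
  push_cast at h0
  linear_combination h0

theorem quadric_dd {m : Fin 6 → ℂ}
    (h : Commute ((∑ i, m i • toC (eF i)) * toC eX * ∑ i, m i • toC (eF i)) (toC eB)) :
    12096 * (m 3 * m 3) + (-48384 - 60480 * om) * (m 3 * m 5) +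
    (5184 - 8640 * om) * (m 4 * m 4) + (-19008 + 3456 * om) * (m 4 * m 5) + (-10368 +
    53568 * om) * (m 5 * m 5) = 0 := by
  have h0 := quadric_eq_zero h
    !![⟨-66, -261⟩, ⟨99, 3⟩, ⟨-153, -270⟩, ⟨60, -114⟩, ⟨354, 159⟩, ⟨-162, -192⟩;
    ⟨0, 0⟩, ⟨159, 246⟩, ⟨-69, 3⟩, ⟨258, 354⟩, ⟨105, 210⟩, ⟨387, 384⟩;
    ⟨-93, 15⟩, ⟨-75, -15⟩, ⟨-93, 15⟩, ⟨-27, 3⟩, ⟨-150, -198⟩, ⟨211, 227⟩;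
    ⟨-492, -594⟩, ⟨-165, 114⟩, ⟨-375, -495⟩, ⟨-204, -3⟩, ⟨132, -66⟩, ⟨-108, 54⟩;
    ⟨225, 150⟩, ⟨120, 276⟩, ⟨-109, -194⟩, ⟨135, 174⟩, ⟨-39, -117⟩, ⟨147, 168⟩;
    ⟨330, 360⟩, ⟨228, 117⟩, ⟨42, 84⟩, ⟨204, 3⟩, ⟨-15, -129⟩, ⟨243, 120⟩]
    !![⟨0, 0⟩, ⟨0, 0⟩, ⟨127, 80⟩, ⟨0, 0⟩, ⟨0, 0⟩, ⟨-216, -144⟩;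
    ⟨-159, -162⟩, ⟨0, 0⟩, ⟨0, 0⟩, ⟨165, 138⟩, ⟨0, 0⟩, ⟨111, 81⟩;
    ⟨-44, -118⟩, ⟨0, 0⟩, ⟨0, 0⟩, ⟨36, 66⟩, ⟨0, 0⟩, ⟨41, 4⟩;
    ⟨270, 243⟩, ⟨0, 0⟩, ⟨0, 0⟩, ⟨-32, -103⟩, ⟨0, 0⟩, ⟨0, 0⟩;
    ⟨0, 0⟩, ⟨123, 33⟩, ⟨-52, -65⟩, ⟨0, 0⟩, ⟨165, 138⟩, ⟨0, 0⟩;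
    ⟨-117, -57⟩, ⟨0, 0⟩, ⟨0, 0⟩, ⟨0, 0⟩, ⟨181, 95⟩, ⟨0, 0⟩]
    !![⟨0, 0⟩, ⟨3696, 2478⟩, ⟨1074, 2550⟩, ⟨4284, -210⟩, ⟨-60996, -31788⟩, ⟨-3822, -4746⟩;
    ⟨-3696, -2478⟩, ⟨0, 0⟩, ⟨-3054, -216⟩, ⟨37308, 53544⟩, ⟨6516, -4602⟩, ⟨67938, -48984⟩;
    ⟨-1074, -2550⟩, ⟨3054, 216⟩, ⟨0, 0⟩, ⟨-7806, -5316⟩, ⟨5970, 8250⟩, ⟨-4752, 62436⟩;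
    ⟨-4284, 210⟩, ⟨-37308, -53544⟩, ⟨7806, 5316⟩, ⟨12096, 0⟩, ⟨31992, 54102⟩, ⟨31278, -3060⟩;
    ⟨60996, 31788⟩, ⟨-6516, 4602⟩, ⟨-5970, -8250⟩, ⟨-31992, -54102⟩, ⟨5184, -8640⟩, ⟨-889410, -1211250⟩;
    ⟨3822, 4746⟩, ⟨-67938, 48984⟩, ⟨4752, -62436⟩, ⟨-79662, -57420⟩, ⟨870402, 1214706⟩, ⟨-10368, 53568⟩]
    (by decide +kernel) (by decide +kernel)
  simp only [Fin.sum_univ_six, Matrix.of_apply, Matrix.cons_val, eisHom_mk] at h0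
  push_cast at h0
  linear_combination h0

theorem quadric_de {m : Fin 6 → ℂ}
    (h : Commute ((∑ i, m i • toC (eF i)) * toC eX * ∑ i, m i • toC (eF i)) (toC eB)) :
    864 * (m 3 * m 4) + (-2592 - 2592 * om) * (m 4 * m 5) + (864 + 864 * om) * (m 5 * m 5) = 0 := by
  have h0 := quadric_eq_zero h
    !![⟨0, 0⟩, ⟨0, 0⟩, ⟨0, 0⟩, ⟨0, 0⟩, ⟨0, 0⟩, ⟨0, 0⟩;
    ⟨0, 0⟩, ⟨0, 0⟩, ⟨0, 0⟩, ⟨0, 0⟩, ⟨0, 0⟩, ⟨0, 0⟩;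
    ⟨0, 0⟩, ⟨0, 0⟩, ⟨0, 0⟩, ⟨0, 0⟩, ⟨-2, -4⟩, ⟨0, 0⟩;
    ⟨0, 0⟩, ⟨0, 0⟩, ⟨0, 0⟩, ⟨0, 0⟩, ⟨0, 0⟩, ⟨0, 0⟩;
    ⟨0, 0⟩, ⟨2, 4⟩, ⟨0, 0⟩, ⟨0, 0⟩, ⟨0, 0⟩, ⟨0, 0⟩;
    ⟨0, 0⟩, ⟨0, 0⟩, ⟨0, 0⟩, ⟨0, 0⟩, ⟨0, 0⟩, ⟨0, 0⟩]
    !![⟨0, 0⟩, ⟨0, 0⟩, ⟨0, 0⟩, ⟨0, 0⟩, ⟨0, 0⟩, ⟨0, 0⟩;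
    ⟨0, 0⟩, ⟨0, 0⟩, ⟨0, 0⟩, ⟨0, 0⟩, ⟨0, 0⟩, ⟨0, 0⟩;
    ⟨0, 0⟩, ⟨1, 2⟩, ⟨0, 0⟩, ⟨0, 0⟩, ⟨-1, -2⟩, ⟨0, 0⟩;
    ⟨0, 0⟩, ⟨0, 0⟩, ⟨0, 0⟩, ⟨0, 0⟩, ⟨0, 0⟩, ⟨0, 0⟩;
    ⟨0, 0⟩, ⟨-1, -2⟩, ⟨0, 0⟩, ⟨0, 0⟩, ⟨1, 2⟩, ⟨0, 0⟩;
    ⟨0, 0⟩, ⟨0, 0⟩, ⟨0, 0⟩, ⟨0, 0⟩, ⟨0, 0⟩, ⟨0, 0⟩]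
    !![⟨0, 0⟩, ⟨-24, -48⟩, ⟨0, 0⟩, ⟨0, 0⟩, ⟨144, 144⟩, ⟨-48, -24⟩;
    ⟨24, 48⟩, ⟨0, 0⟩, ⟨0, 0⟩, ⟨0, -144⟩, ⟨0, 0⟩, ⟨-168, -696⟩;
    ⟨0, 0⟩, ⟨0, 0⟩, ⟨0, 0⟩, ⟨-24, 24⟩, ⟨-48, -24⟩, ⟨144, 0⟩;
    ⟨0, 0⟩, ⟨0, 144⟩, ⟨24, -24⟩, ⟨0, 0⟩, ⟨696, 528⟩, ⟨0, 0⟩;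
    ⟨-144, -144⟩, ⟨0, 0⟩, ⟨48, 24⟩, ⟨168, -528⟩, ⟨0, 0⟩, ⟨-864, 3024⟩;
    ⟨48, 24⟩, ⟨168, 696⟩, ⟨-144, 0⟩, ⟨0, 0⟩, ⟨-1728, -5616⟩, ⟨864, 864⟩]
    (by decide +kernel) (by decide +kernel)
  simp only [Fin.sum_univ_six, Matrix.of_apply, Matrix.cons_val, eisHom_mk] at h0
  push_cast at h0
  linear_combination h0

theorem om_ne_zero : om ≠ 0 := Complex.exp_ne_zero _

/-- The common zeros of the quadrics lie on the two lines spanned by the first two coordinates,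
which correspond to M being a multiple of A or of A⁻¹. -/
theorem coefficients_of_commute {m : Fin 6 → ℂ}
    (h : Commute ((∑ i, m i • toC (eF i)) * toC eX * ∑ i, m i • toC (eF i)) (toC eB)) :
    m 2 = 0 ∧ m 3 = 0 ∧ m 4 = 0 ∧ m 5 = 0 ∧ m 0 * m 1 = 0 := by
  have h_ab := quadric_ab h
  have h_ad := quadric_ad h
  have h_ae := quadric_ae h
  have h_cc := quadric_cc h
  have h_cd := quadric_cd h
  have h_cf := quadric_cf h
  have h_dd := quadric_dd h
  have h_de := quadric_de h
  have h4 : m 4 = 0 := by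
    -- An ideal membership certificate: the cube of `m 4` is a combination of the quadrics with
    -- linear coefficients. The final multiple of `om_sq` absorbs the ω² arising from products of
    -- coefficients.
    have : m 4 ^ 3 = 0 := by
      linear_combination
        (373/612864 - 167/5515776 * om) * m 5 * h_dd + (25/5515776 +
        83/5515776 * om) * m 0 * h_dd + (37/172368 - 187/2757888 * om) * m 4 * h_dd +
        (-37/12312 + 187/196992 * om) * m 3 * h_de +
        (41/49248 - 61/393984 * om) * m 0 * h_de + (13/43776 - 25/131328 * om) * m 2 * h_de +
        (-797/43776 - 3281/393984 * om) * m 5 * h_de + (1453/196992 +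
        175/393984 * om) * m 4 * h_de + (-1/28728 - 13/612864 * om) * m 5 * h_cf + (1/9576 +
        13/204288 * om) * m 4 * h_cf + (-199/5515776 - 211/5515776 * om) * m 3 * h_cf +
        (-25/5515776 - 83/5515776 * om) * m 3 * h_ad + (-5/87552 +
        1/131328 * om) * m 5 * h_ad + (-125/5515776 - 13/306432 * om) * m 4 * h_ad +
        (-203/393984 + 295/393984 * om) * m 3 * h_ae + (205/65664 +
        377/131328 * om) * m 5 * h_ae + (-35/196992 - 77/393984 * om) * m 4 * h_ae +
        (199/131328 + 211/131328 * om) * m 5 * h_cd + (-13/14592 +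
        25/43776 * om) * m 4 * h_cd +
        ((415/456) * (m 0 * m 3 * m 5) + (415/3192) * (m 0 * m 4 * m 4) +
          (-1447/3192) * (m 0 * m 4 * m 5) + (-1073/1596) * (m 0 * m 5 * m 5) +
          (-75/152) * (m 2 * m 4 * m 5) + (25/152) * (m 2 * m 5 * m 5) +
          (-659/76) * (m 3 * m 3 * m 5) + (-6037/1064) * (m 3 * m 4 * m 4) +
          (-11573/3192) * (m 3 * m 4 * m 5) + (6201/1064) * (m 3 * m 5 * m 5) +
          (979/228) * (m 4 * m 4 * m 4) + (-123/56) * (m 4 * m 4 * m 5) +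
          (15319/399) * (m 4 * m 5 * m 5) + (-22147/3192) * (m 5 * m 5 * m 5)) * om_sq
    exact pow_eq_zero_iff (by norm_num) |>.mp this
  simp only [h4, mul_zero, add_zero, zero_add] at h_ab h_cc h_dd h_de
  have h5 : m 5 = 0 := by
    -- With `m 4 = 0` the quadric `h_de` is (1 + ω) times the square of `m 5`, and 1 + ω = −ω².
    have : om ^ 2 * (m 5 * m 5) = 0 := by
      linear_combination (-1 / 864) * h_de + m 5 * m 5 * om_sq
    exact mul_self_eq_zero.mp ((mul_eq_zero.mp this).resolve_left (pow_ne_zero _ om_ne_zero))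
  simp only [h5, mul_zero, add_zero] at h_ab h_cc h_dd
  have h3 : m 3 = 0 := mul_self_eq_zero.mp ((mul_eq_zero.mp h_dd).resolve_left (by norm_num))
  have h2 : m 2 = 0 := mul_self_eq_zero.mp ((mul_eq_zero.mp h_cc).resolve_left (by norm_num))
  exact ⟨h2, h3, h4, h5, (mul_eq_zero.mp h_ab).resolve_left (by norm_num)⟩

/-! ### The commutant of A. -/

theorem toC_mul {l m n : Type*} [Fintype m] (M : Matrix l m Eis) (N : Matrix m n Eis) :
    toC (M * N) = toC M * toC N := Matrix.map_mul

theorem toC_one : toC (1 : Matrix (Fin 6) (Fin 6) Eis) = 1 :=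
  Matrix.map_one _ (map_zero _) (map_one _)

theorem toC_ofNat : toC (24 : Matrix (Fin 6) (Fin 6) Eis) = (24 : ℂ) • 1 := by
  ext i j
  have h24 : eisHom 24 = 24 := map_ofNat eisHom 24
  by_cases h : i = j <;> simp [Matrix.ofNat_apply, h, h24]

theorem commute_eF {M : Matrix (Fin 6) (Fin 6) ℂ} (h : Commute M (toC eA)) (k : Fin 6) :
    Commute M (toC (eF k)) := by
  have h' : Commute M (toC eAinv) := by
    have h1 : toC eA * toC eAinv = 1 := by rw [← toC_mul, eA_mul_eAinv, toC_one]
    have h2 : toC eAinv * toC eA = 1 := by rw [← toC_mul, eAinv_mul_eA, toC_one]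
    calc M * toC eAinv = toC eAinv * (toC eA * M) * toC eAinv := by
          rw [← mul_assoc, h2, one_mul]
      _ = toC eAinv * M * (toC eA * toC eAinv) := by rw [← h.eq]; simp only [mul_assoc]
      _ = toC eAinv * M := by rw [h1, mul_one]
  have h2 : Commute M (toC eA2) := by
    rw [← eA_mul_eA, toC_mul]; exact h.mul_right h
  have h2' : Commute M (toC eAinv2) := by
    rw [← eAinv_mul_eAinv, toC_mul]; exact h'.mul_right h'
  have h3 : Commute M (toC eA3) := by
    rw [← eA2_mul_eA, toC_mul]; exact h2.mul_right h
  have h1 : Commute M (toC 1) := by rw [toC_one]; exact Commute.one_right _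
  fin_cases k
  exacts [h, h', h1, h2, h2', h3]

theorem toC_eF_mul_eU (k i : Fin 6) : (toC (eF k) * toC eU) i 0 = toC eK i k := by
  rw [← toC_mul]
  exact congrArg eisHom (eF_mul_eU k i)

theorem toC_eL_mul_eF (k i : Fin 6) : (toC eL * toC (eF k)) 0 i = toC eR k i := by
  rw [← toC_mul]
  exact congrArg eisHom (eL_mul_eF k i)

/-- The vector `eU` is separating for the commutant of `exA`. -/
theorem eq_zero_of_commute {D : Matrix (Fin 6) (Fin 6) ℂ} (h : Commute D (toC eA))
    (hD : D * toC eU = 0) : D = 0 := by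
  -- D kills each `eF k * eU`, since it commutes with `eF k` and kills `eU`. These vectors are the
  -- columns of the invertible matrix `eK`.
  have hK : D * toC eK = 0 := by
    ext i k
    have h1 : D * (toC (eF k) * toC eU) = 0 := by
      rw [← Matrix.mul_assoc, (commute_eF h k).eq, Matrix.mul_assoc, hD, Matrix.mul_zero]
    calc (D * toC eK) i k = ∑ j, D i j * (toC (eF k) * toC eU) j 0 := by
          simp only [toC_eF_mul_eU]; rfl
      _ = (D * (toC (eF k) * toC eU)) i 0 := Matrix.mul_apply.symm
      _ = 0 := by rw [h1]; rfl
  have h24 : (24 : ℂ) • D = 0 := by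
    rw [← mul_one D, ← mul_smul_comm, ← toC_ofNat, ← eK_mul_eKadj, toC_mul, ← mul_assoc, hK,
      zero_mul]
  exact (smul_eq_zero.mp h24).resolve_left (by norm_num)

/-- The commutant of `exA` consists of the combinations of the matrices `eF k`. -/
theorem eq_sum_of_commute {M : Matrix (Fin 6) (Fin 6) ℂ} (hM : Commute M (toC eA)) :
    ∃ m : Fin 6 → ℂ, M = ∑ i, m i • toC (eF i) := by
  -- The coefficients are the coordinates of `M * toC eU` in the basis of vectors `eF k * eU`. Both
  -- sides then agree on the separating vector, hence are equal.
  refine ⟨fun k => (24 : ℂ)⁻¹ * (toC eKadj * (M * toC eU)) k 0, ?_⟩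
  rw [← sub_eq_zero]
  refine eq_zero_of_commute (hM.sub_left (Commute.sum_left _ _ _ fun k _ =>
    (commute_eF (Commute.refl _) k).symm.smul_left _)) ?_
  rw [Matrix.sub_mul, sub_eq_zero]
  ext i j
  rw [Subsingleton.elim j 0, Matrix.sum_mul, Matrix.sum_apply]
  simp only [Matrix.smul_mul, Matrix.smul_apply, toC_eF_mul_eU, smul_eq_mul]
  have h : toC eK * (toC eKadj * (M * toC eU)) = (24 : ℂ) • (M * toC eU) := by
    rw [← Matrix.mul_assoc, ← toC_mul, eK_mul_eKadj, toC_ofNat, Matrix.smul_mul, Matrix.one_mul]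
  have h' := congrFun (congrFun h i) 0
  rw [Matrix.mul_apply, Matrix.smul_apply, smul_eq_mul] at h'
  rw [← mul_right_inj' (show (24 : ℂ) ≠ 0 by norm_num), ← h', Finset.mul_sum]
  refine Finset.sum_congr rfl fun k _ => ?_
  ring

/-! ### Excluding candidates for the image of `s₁s₂`. -/

/-- A matrix of order three with the trace of its inverse is not a multiple of a matrix of order
three with the trace of `eY` or of its inverse. -/
theorem false_of_smul {P Q : Matrix (Fin 6) (Fin 6) ℂ} {c : ℂ} (hP : P = c • Q)
    (hP3 : P * P * P = 1) (htr : P.trace = (P * P).trace) (hQ3 : Q * Q * Q = 1)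
    (hQ : Q.trace ^ 3 ≠ (Q * Q).trace ^ 3) : False := by
  subst hP
  simp only [smul_mul_assoc, mul_smul_comm, smul_smul, hQ3] at hP3
  -- Since c³ = 1, the trace condition reads tr Q = c · tr Q², and cubing eliminates c.
  have hc : c * (c * c) = 1 := by simpa using congrFun (congrFun hP3 0) 0
  simp only [smul_mul_assoc, mul_smul_comm, smul_smul, Matrix.trace_smul, smul_eq_mul] at htr
  have hc0 : c ≠ 0 := by rintro rfl; simp at hc
  have h : Q.trace = c * (Q * Q).trace := mul_left_cancel₀ hc0 (by rw [htr]; ring)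
  apply hQ
  rw [h]
  linear_combination (Q * Q).trace ^ 3 * hc

theorem eX_mul_eB : eX * eB = eA * eX := by decide +kernel
theorem eX_mul_eA : eX * eA = eB * eX := by decide +kernel
theorem eX_mul_eA_cube : eX * eA * (eX * eA) * (eX * eA) = 1 := by
  decide +kernel
theorem eX_mul_eAinv_cube : eX * eAinv * (eX * eAinv) * (eX * eAinv) = 1 := by
  decide +kernel
theorem trace_eX_mul_eA : (eX * eA).trace = ⟨1, -1⟩ := by decide +kernel
theorem trace_eX_mul_eAinv : (eX * eAinv).trace = ⟨2, 1⟩ := by decide +kernel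
theorem trace_eX_mul_eA_sq : (eX * eA * (eX * eA)).trace = ⟨2, 1⟩ := by decide +kernel
theorem trace_eX_mul_eAinv_sq : (eX * eAinv * (eX * eAinv)).trace = ⟨1, -1⟩ := by decide +kernel

theorem trace_toC (M : Matrix (Fin 6) (Fin 6) Eis) : (toC M).trace = eisHom M.trace :=
  (AddMonoidHom.map_trace eisHom.toAddMonoidHom M).symm

/-- Conjugation by X exchanges A and B, and so M = XP lies in the commutant of A. As P² = P⁻¹
carries B back to A, MXM = XP² lies in the commutant of B. The quadrics therefore apply to the
coefficients of M. -/
theorem not_commute_of_cube_eq_one {P : Matrix (Fin 6) (Fin 6) ℂ} (hP : P * toC eA = toC eB * P)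
    (hP3 : P * P * P = 1) (htr : P.trace = (P * P).trace) : False := by
  have hXX : toC eX * toC eX = 1 := by rw [← toC_mul, eX_mul_eX, toC_one]
  have hXA : toC eX * toC eA = toC eB * toC eX := by rw [← toC_mul, ← toC_mul, eX_mul_eA]
  have hXB : toC eX * toC eB = toC eA * toC eX := by rw [← toC_mul, ← toC_mul, eX_mul_eB]
  have hPB : P * P * toC eB = toC eA * (P * P) := by
    calc P * P * toC eB = P * P * (toC eB * P) * (P * P) := by
          simp only [mul_assoc] at hP3 ⊢; rw [hP3, mul_one]
      _ = P * P * P * toC eA * (P * P) := by rw [← hP]; simp only [mul_assoc]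
      _ = toC eA * (P * P) := by rw [hP3, one_mul]
  have hM : Commute (toC eX * P) (toC eA) := by
    change toC eX * P * toC eA = toC eA * (toC eX * P)
    rw [mul_assoc, hP, ← mul_assoc, hXB, mul_assoc]
  obtain ⟨m, hm⟩ := eq_sum_of_commute hM
  have hPm : P = toC eX * ∑ i, m i • toC (eF i) := by
    rw [← hm, ← mul_assoc, hXX, one_mul]
  have hcomm : Commute ((∑ i, m i • toC (eF i)) * toC eX * ∑ i, m i • toC (eF i)) (toC eB) := by
    rw [← hm]
    have h1 : toC eX * P * toC eX * (toC eX * P) = toC eX * (P * P) := by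
      calc _ = toC eX * P * (toC eX * toC eX) * P := by simp only [mul_assoc]
        _ = _ := by rw [hXX, mul_one, mul_assoc]
    rw [h1]
    change toC eX * (P * P) * toC eB = toC eB * (toC eX * (P * P))
    rw [mul_assoc, hPB, ← mul_assoc, hXA, mul_assoc]
  obtain ⟨h2, h3, h4, h5, h01⟩ := coefficients_of_commute hcomm
  simp only [Fin.sum_univ_six, h2, h3, h4, h5, zero_smul, add_zero] at hPm
  have hne : om ≠ -1 / 2 := by
    intro h
    have := om_sq
    rw [h] at this
    norm_num at this
  -- For both candidates Q the difference of the cubes of tr Q and tr Q² is ±6(1 + 2ω).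
  have hne' : (1 + 2 * om) ≠ 0 := fun h => hne (by linear_combination h / 2)
  rcases mul_eq_zero.mp h01 with h | h
  · refine false_of_smul (Q := toC (eX * eAinv)) (c := m 1) ?_ hP3 htr ?_ ?_
    · rw [hPm, h, zero_smul, zero_add, mul_smul_comm, toC_mul]; rfl
    · rw [← toC_mul, ← toC_mul, eX_mul_eAinv_cube, toC_one]
    · rw [← toC_mul, trace_toC, trace_toC, trace_eX_mul_eAinv, trace_eX_mul_eAinv_sq]
      simp only [eisHom_mk]
      push_cast
      intro h'
      apply hne'
      linear_combination (1 / 6) * h' - (1 / 6) * (2 * om + 1) * om_sq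
  · refine false_of_smul (Q := toC (eX * eA)) (c := m 0) ?_ hP3 htr ?_ ?_
    · rw [hPm, h, zero_smul, add_zero, mul_smul_comm, toC_mul]; rfl
    · rw [← toC_mul, ← toC_mul, eX_mul_eA_cube, toC_one]
    · rw [← toC_mul, trace_toC, trace_toC, trace_eX_mul_eA, trace_eX_mul_eA_sq]
      simp only [eisHom_mk]
      push_cast
      intro h'
      apply hne'
      linear_combination (-1 / 6) * h' - (1 / 6) * (2 * om + 1) * om_sq

/-! ### Eigenprojections of an endomorphism of order three, and inverting involutions. -/

section EigenProjections

open Module LinearMap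

variable {V : Type*} [AddCommGroup V] [Module ℂ V]

/-- The projection onto the eigenspace for the eigenvalue `ζ` of an endomorphism `P` with
`P ^ 3 = 1`, where `ζ ^ 3 = 1`. -/
noncomputable def cubeProj (ζ : ℂ) (P : End ℂ V) : End ℂ V :=
  (3⁻¹ : ℂ) • (1 + ζ ^ 2 • P + ζ • P ^ 2)

variable {P : End ℂ V}

theorem mul_cubeProj (hP : P ^ 3 = 1) {ζ : ℂ} (hζ : ζ ^ 3 = 1) :
    P * cubeProj ζ P = ζ • cubeProj ζ P := by
  have h1 : P * P = P ^ 2 := (pow_two P).symm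
  have h2 : P * P ^ 2 = 1 := by rw [← pow_succ', hP]
  simp only [cubeProj, mul_smul_comm, mul_add, mul_one, h1, h2]
  match_scalars <;> first | ring1 | linear_combination (-3⁻¹ : ℂ) * hζ

theorem cubeProj_mul (hP : P ^ 3 = 1) {ζ : ℂ} (hζ : ζ ^ 3 = 1) :
    cubeProj ζ P * P = ζ • cubeProj ζ P := by
  rw [← mul_cubeProj hP hζ]
  simp only [cubeProj, mul_smul_comm, mul_add, smul_mul_assoc, add_mul, mul_one, one_mul,
    pow_two, mul_assoc]

theorem cubeProj_mul_of_mul {e : End ℂ V} {η : ℂ} (ζ : ℂ) (he : P * e = η • e) :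
    cubeProj ζ P * e = (3⁻¹ * (1 + ζ ^ 2 * η + ζ * η ^ 2)) • e := by
  simp only [cubeProj, smul_mul_assoc, add_mul, one_mul, pow_two P, mul_assoc, he, mul_smul_comm]
  match_scalars
  ring

theorem cubeProj_idem (hP : P ^ 3 = 1) {ζ : ℂ} (hζ : ζ ^ 3 = 1) :
    IsIdempotentElem (cubeProj ζ P) := by
  rw [IsIdempotentElem, cubeProj_mul_of_mul ζ (mul_cubeProj hP hζ)]
  convert one_smul ℂ _
  linear_combination (2 / 3 : ℂ) * hζ

theorem cubeProj_mul_cubeProj (hP : P ^ 3 = 1) {ζ η : ℂ} (hζ : ζ ^ 3 = 1) (hη : η ^ 3 = 1)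
    (h : ζ ≠ η) : cubeProj ζ P * cubeProj η P = 0 := by
  rw [cubeProj_mul_of_mul ζ (mul_cubeProj hP hη)]
  convert zero_smul ℂ _
  -- The product expands to η(ζ³ − 1) − ζ(η³ − 1).
  have : (ζ - η) * (1 + ζ ^ 2 * η + ζ * η ^ 2) = 0 := by
    linear_combination η * hζ - ζ * hη
  rw [(mul_eq_zero.mp this).resolve_left (sub_ne_zero.mpr h), mul_zero]

/-- Rescaling by a cube root of unity permutes the eigenvalues: ζ for ηP is ζη⁻¹ = ζη² for P. This
allows any equal pair of multiplicities to be moved to ω and ω². -/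
theorem cubeProj_smul (ζ η : ℂ) (P : End ℂ V) (hη : η ^ 3 = 1) :
    cubeProj ζ (η • P) = cubeProj (ζ * η ^ 2) P := by
  simp only [cubeProj, smul_pow]
  match_scalars
  · simp
  · linear_combination (-3⁻¹ : ℂ) * ζ ^ 2 * η * hη
  · ring

theorem om_cube : om ^ 3 = 1 := by
  linear_combination (om - 1) * om_sq

theorem om_ne_one : om ≠ 1 := by
  intro h
  have := om_sq
  rw [h] at this
  norm_num at this

theorem cubeProj_sum (P : End ℂ V) :
    cubeProj 1 P + cubeProj om P + cubeProj (om ^ 2) P = 1 := by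
  simp only [cubeProj]
  match_scalars
  · norm_num
  · linear_combination (3⁻¹ : ℂ) * (om ^ 2 - om + 1) * om_sq
  · linear_combination (3⁻¹ : ℂ) * om_sq

variable [FiniteDimensional ℂ V]

/-- Taking traces turns a decomposition of 1 into idempotents into an equation between dimensions.
-/
theorem trace_of_idem {e : End ℂ V} (he : IsIdempotentElem e) :
    trace ℂ V e = finrank ℂ (range e) :=
  he.isProj_range.trace

theorem finrank_cubeProj_sum (hP : P ^ 3 = 1) :
    finrank ℂ (range (cubeProj 1 P)) + finrank ℂ (range (cubeProj om P)) +
      finrank ℂ (range (cubeProj (om ^ 2) P)) = finrank ℂ V := by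
  have h2 : (om ^ 2) ^ 3 = 1 := by rw [← pow_mul, mul_comm, pow_mul, om_cube, one_pow]
  have h := congrArg (trace ℂ V) (cubeProj_sum P)
  rw [map_add, map_add, trace_of_idem (cubeProj_idem hP (one_pow 3)),
    trace_of_idem (cubeProj_idem hP om_cube), trace_of_idem (cubeProj_idem hP h2), trace_one] at h
  exact_mod_cast h

/-- Idempotents of equal rank are equivalent. -/
theorem exists_equivalence {e f : End ℂ V} (he : IsIdempotentElem e) (hf : IsIdempotentElem f)
    (h : finrank ℂ (range e) = finrank ℂ (range f)) :
    ∃ u v : End ℂ V, u * e = u ∧ f * u = u ∧ v * f = v ∧ e * v = v ∧ v * u = e ∧ u * v = f := by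
  let φ := LinearEquiv.ofFinrankEq _ _ h
  have he' : ∀ x : range e, e.rangeRestrict x = x := fun ⟨x, y, hy⟩ => Subtype.ext (by
    subst hy; exact congrArg (· y) he)
  have hf' : ∀ x : range f, f.rangeRestrict x = x := fun ⟨x, y, hy⟩ => Subtype.ext (by
    subst hy; exact congrArg (· y) hf)
  -- Project to one range, cross by the isomorphism `φ` or its inverse, and include the other range.
  refine ⟨(range f).subtype ∘ₗ φ.toLinearMap ∘ₗ e.rangeRestrict,
    (range e).subtype ∘ₗ φ.symm.toLinearMap ∘ₗ f.rangeRestrict, ?_, ?_, ?_, ?_, ?_, ?_⟩ <;>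
    refine LinearMap.ext fun x => ?_
  · exact congrArg (fun y => (φ y : V)) (Subtype.ext (congrArg (· x) he))
  · exact congrArg Subtype.val (hf' (φ (e.rangeRestrict x)))
  · exact congrArg (fun y => (φ.symm y : V)) (Subtype.ext (congrArg (· x) hf))
  · exact congrArg Subtype.val (he' (φ.symm (f.rangeRestrict x)))
  · simp [hf']
  · simp [he']

/-- An automorphism of order three whose primitive eigenvalues have equal multiplicities is
inverted by an involution. -/
theorem exists_involution (hP : P ^ 3 = 1)
    (h : finrank ℂ (range (cubeProj om P)) = finrank ℂ (range (cubeProj (om ^ 2) P))) :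
    ∃ S : End ℂ V, S ^ 2 = 1 ∧ S * P * S = P ^ 2 := by
  have h3 : (om ^ 2) ^ 3 = 1 := by rw [← pow_mul, mul_comm, pow_mul, om_cube, one_pow]
  have hne : om ≠ om ^ 2 := fun h => om_ne_one
    (mul_left_cancel₀ om_ne_zero (by rw [← pow_two, ← h, mul_one]))
  obtain ⟨u, v, hue, hfu, hvf, hev, hvu, huv⟩ :=
    exists_equivalence (cubeProj_idem hP om_cube) (cubeProj_idem hP h3) h
  have hef := cubeProj_mul_cubeProj hP om_cube h3 hne
  have hfe := cubeProj_mul_cubeProj hP h3 om_cube hne.symm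
  have hPe := mul_cubeProj hP om_cube
  have hPf := mul_cubeProj hP h3
  have heP := cubeProj_mul hP om_cube
  have hfP := cubeProj_mul hP h3
  have hge := cubeProj_mul_cubeProj hP (one_pow 3) om_cube om_ne_one.symm
  have hgf := cubeProj_mul_cubeProj hP (one_pow 3) h3 (fun h => om_ne_one (by
    linear_combination om * h + om_cube))
  have heg := cubeProj_mul_cubeProj hP om_cube (one_pow 3) om_ne_one
  have hfg := cubeProj_mul_cubeProj hP h3 (one_pow 3) (fun h => om_ne_one (by
    linear_combination -om * h + om_cube))
  have hgg := cubeProj_idem hP (one_pow 3)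
  have hPg := mul_cubeProj hP (one_pow 3)
  have hsum := cubeProj_sum P
  set e := cubeProj om P
  set f := cubeProj (om ^ 2) P
  set g := cubeProj 1 P
  have hdecomp : P = g + om • e + om ^ 2 • f := by
    rw [← mul_one P, ← hsum, mul_add, mul_add, hPg, hPe, hPf, one_smul]
  have hP2 : P ^ 2 = g + om ^ 2 • e + om • f := by
    rw [pow_two]
    nth_rewrite 2 [hdecomp]
    rw [mul_add, mul_add, hPg, mul_smul_comm, mul_smul_comm, hPe, hPf, smul_smul, smul_smul,
      one_smul, ← pow_two]
    congr 2
    linear_combination om * om_cube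
  have hgu : g * u = 0 := by rw [← hfu, ← mul_assoc, hgf, zero_mul]
  have hgv : g * v = 0 := by rw [← hev, ← mul_assoc, hge, zero_mul]
  have hug : u * g = 0 := by rw [← hue, mul_assoc, heg, mul_zero]
  have hvg : v * g = 0 := by rw [← hvf, mul_assoc, hfg, mul_zero]
  have huu : u * u = 0 := by
    nth_rewrite 1 [← hue]
    rw [← hfu, mul_assoc, ← mul_assoc e, hef, zero_mul, mul_zero]
  have hvv : v * v = 0 := by
    nth_rewrite 1 [← hvf]
    rw [← hev, mul_assoc, ← mul_assoc f, hfe, zero_mul, mul_zero]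
  have huP : u * P = om • u := by
    nth_rewrite 1 [← hue]
    rw [mul_assoc, heP, mul_smul_comm, hue]
  have hvP : v * P = om ^ 2 • v := by
    nth_rewrite 1 [← hvf]
    rw [mul_assoc, hfP, mul_smul_comm, hvf]
  have hgP : g * P = g := by rw [cubeProj_mul hP (one_pow 3), one_smul]
  -- The involution fixes the 1-eigenspace and exchanges the ω- and ω²-eigenspaces through u and v.
  refine ⟨g + u + v, ?_, ?_⟩
  · simp only [pow_two, mul_add, add_mul, hgu, hgv, hug, hvg, huu, hvv, huv, hvu, hgg.eq, add_zero,
      zero_add, ← hsum]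
  · rw [hP2]
    simp only [mul_add, add_mul, huP, hvP, hgP, smul_mul_assoc, hgu, hgv, hug, hvg, huu, hvv, huv,
      hvu, hgg.eq, add_zero, zero_add, smul_zero]

end EigenProjections

open Module LinearMap

/-! ### Irreducible representations of the braid group and the eigenspaces of `σ₁σ₂`. -/

section Irreducible

variable {V : Type*} [AddCommGroup V] [Module ℂ V]

theorem eq_bot_or_eq_top_of_invariant {G : Type*} [Group G] {R : Representation ℂ G V}
    (hR : R.IsIrreducible) (W : Submodule ℂ V) (hW : ∀ g, ∀ v ∈ W, R g v ∈ W) :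
    W = ⊥ ∨ W = ⊤ := by
  have := hR
  rcases eq_bot_or_eq_top (⟨W, fun g v hv => hW g v hv⟩ : Subrepresentation R) with h | h
  · exact Or.inl (congrArg Subrepresentation.toSubmodule h)
  · exact Or.inr (congrArg Subrepresentation.toSubmodule h)

theorem nontrivial_of_irreducible {G : Type*} [Group G] {R : Representation ℂ G V}
    (hR : R.IsIrreducible) : Nontrivial V := by
  have := hR
  by_contra h
  rw [not_nontrivial_iff_subsingleton] at h
  exact bot_ne_top (α := Subrepresentation R)
    (Subrepresentation.toSubmodule_injective (Subsingleton.elim _ _))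

theorem apply_inv_eq_smul {G : Type*} [Group G] {R : Representation ℂ G V} {g : G} {v : V} {c : ℂ}
    (hv : v ≠ 0) (h : R g v = c • v) : R g⁻¹ v = c⁻¹ • v := by
  have h1 : c • R g⁻¹ v = v := by
    rw [← map_smul, ← h, ← Module.End.mul_apply, ← map_mul, inv_mul_cancel, map_one]; rfl
  have hc : c ≠ 0 := by
    rintro rfl
    rw [zero_smul] at h1
    exact hv h1.symm
  rw [eq_inv_smul_iff₀ hc, h1]

variable {R : Representation ℂ B3 V}

/-- The half twist `σ₁σ₂σ₁` of the braid group. -/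
def halfTwist : B3 :=
  PresentedGroup.of BraidGen.sigma₁ * PresentedGroup.of BraidGen.sigma₂ *
    PresentedGroup.of BraidGen.sigma₁

/-- The element `σ₁σ₂` of the braid group. -/
def rotation : B3 := PresentedGroup.of BraidGen.sigma₁ * PresentedGroup.of BraidGen.sigma₂

theorem rotation_cube : rotation ^ 3 = halfTwist ^ 2 := by
  have h := braid_relation
  rw [rotation, halfTwist, pow_two]
  nth_rewrite 2 [h]
  simp only [pow_succ, pow_zero, one_mul, mul_assoc]

theorem rotation_mul_sigma₁ : rotation * PresentedGroup.of BraidGen.sigma₁ = halfTwist := rfl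

theorem sigma₂_mul_rotation : PresentedGroup.of BraidGen.sigma₂ * rotation = halfTwist := by
  rw [rotation, halfTwist, braid_relation, mul_assoc]

/-- Conjugation by the half twist exchanges the two generators, and so its square fixes both. -/
theorem halfTwist_sq_commute (g : B3) : Commute g (halfTwist ^ 2) := by
  have h₁ : halfTwist * PresentedGroup.of BraidGen.sigma₁ =
      PresentedGroup.of BraidGen.sigma₂ * halfTwist := by
    conv_lhs => rw [← sigma₂_mul_rotation]
    rw [mul_assoc, rotation_mul_sigma₁]
  have h₂ : halfTwist * PresentedGroup.of BraidGen.sigma₂ =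
      PresentedGroup.of BraidGen.sigma₁ * halfTwist := by
    conv_rhs => rw [halfTwist, braid_relation]
    simp only [halfTwist, mul_assoc]
  refine braid_induction (C := fun g => Commute g (halfTwist ^ 2)) ?_ ?_ (Commute.one_left _)
    (fun g h hg hh => hg.mul_left hh) (fun g hg => hg.inv_left) g
  · change _ * _ = _ * _
    rw [pow_two, mul_assoc, h₁, ← mul_assoc, ← mul_assoc, h₂]
  · change _ * _ = _ * _
    rw [pow_two, mul_assoc, h₂, ← mul_assoc, ← mul_assoc, h₁]

/-- A common eigenvector of the half twist and of `σ₁σ₂` spans an invariant line. -/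
theorem finrank_eq_one_of_common_eigenvector (hR : R.IsIrreducible) {v : V} (hv : v ≠ 0) {α β : ℂ}
    (hα : R halfTwist v = α • v) (hβ : R rotation v = β • v) : finrank ℂ V = 1 := by
  have hβ' := apply_inv_eq_smul hv hβ
  -- The half twist and the rotation generate: σ₁ is rotation⁻¹ · halfTwist and σ₂ is halfTwist ·
  -- rotation⁻¹.
  have h : ∀ g, ∃ c : ℂ, R g v = c • v := by
    refine braid_induction ?_ ?_ ⟨1, by simp⟩ ?_ fun g ⟨c, hc⟩ => ⟨c⁻¹, apply_inv_eq_smul hv hc⟩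
    · refine ⟨α * β⁻¹, ?_⟩
      rw [← inv_mul_cancel_left rotation (PresentedGroup.of BraidGen.sigma₁),
        rotation_mul_sigma₁, map_mul, Module.End.mul_apply, hα, map_smul, hβ', smul_smul]
    · refine ⟨β⁻¹ * α, ?_⟩
      rw [← mul_inv_cancel_right (PresentedGroup.of BraidGen.sigma₂) rotation,
        sigma₂_mul_rotation, map_mul, Module.End.mul_apply, hβ', map_smul, hα, smul_smul]
    · rintro g h ⟨c, hc⟩ ⟨d, hd⟩
      exact ⟨d * c, by rw [map_mul, Module.End.mul_apply, hd, map_smul, hc, smul_smul]⟩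
  have hinv : ∀ g, ∀ w ∈ ℂ ∙ v, R g w ∈ ℂ ∙ v := by
    intro g w hw
    obtain ⟨t, rfl⟩ := Submodule.mem_span_singleton.mp hw
    obtain ⟨c, hc⟩ := h g
    rw [map_smul, hc]
    exact Submodule.smul_mem _ _ (Submodule.smul_mem _ _ (Submodule.mem_span_singleton_self v))
  rcases eq_bot_or_eq_top_of_invariant hR _ hinv with h' | h'
  · exact absurd (Submodule.span_singleton_eq_bot.mp h') hv
  · rw [← finrank_top, ← h', finrank_span_singleton hv]

variable [FiniteDimensional ℂ V]

/-- Schur's lemma: an endomorphism which commutes with an irreducible representation is a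
scalar. -/
theorem exists_eq_smul_one {G : Type*} [Group G] {R : Representation ℂ G V}
    (hR : R.IsIrreducible) (C : End ℂ V) (hC : ∀ g, Commute (R g) C) : ∃ c : ℂ, C = c • 1 := by
  have := nontrivial_of_irreducible hR
  obtain ⟨c, hc⟩ := Module.End.exists_eigenvalue C
  refine ⟨c, ?_⟩
  have hinv : ∀ g, ∀ v ∈ Module.End.eigenspace C c, R g v ∈ Module.End.eigenspace C c := by
    intro g v hv
    rw [Module.End.mem_eigenspace_iff] at hv ⊢
    rw [← map_smul, ← hv]
    exact (congrArg (· v) (hC g).eq).symm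
  rcases eq_bot_or_eq_top_of_invariant hR _ hinv with h | h
  · exact absurd h hc
  · refine LinearMap.ext fun v => ?_
    have hv : v ∈ Module.End.eigenspace C c := h ▸ Submodule.mem_top
    simpa using Module.End.mem_eigenspace_iff.mp hv

/-- The eigenspaces of `σ₁σ₂` in an irreducible representation of dimension at least two have at
most half the dimension. -/
theorem two_mul_finrank_cubeProj_le (hR : R.IsIrreducible) (hV : finrank ℂ V ≠ 1) {k l : ℂ}
    (hk : k ≠ 0) (hl : l ≠ 0)
    (hP : (k • R rotation) ^ 3 = 1) (hQ : (l • R halfTwist) ^ 2 = 1) {ζ : ℂ} (hζ : ζ ^ 3 = 1) :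
    2 * finrank ℂ (range (cubeProj ζ (k • R rotation))) ≤ finrank ℂ V := by
  obtain ⟨Q, hQdef⟩ : ∃ Q, Q = l • R halfTwist := ⟨_, rfl⟩
  rw [← hQdef] at hQ
  set p := cubeProj ζ (k • R rotation) with hp
  -- For ε = ±1 this is the projection onto the ε-eigenspace of Q.
  let q : ℂ → End ℂ V := fun ε => (2⁻¹ : ℂ) • (1 + ε • Q)
  have hQq : ∀ ε : ℂ, ε ^ 2 = 1 → Q * q ε = ε • q ε := by
    intro ε hε
    simp only [q, mul_smul_comm, mul_add, mul_one, ← pow_two, hQ]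
    match_scalars <;> first | ring1 | linear_combination (-2⁻¹ : ℂ) * hε
  have hqq : ∀ ε : ℂ, ε ^ 2 = 1 → IsIdempotentElem (q ε) := by
    intro ε hε
    change (2⁻¹ : ℂ) • (1 + ε • Q) * q ε = q ε
    rw [smul_mul_assoc, add_mul, smul_mul_assoc, hQq ε hε, one_mul, smul_smul, ← pow_two, hε]
    match_scalars <;> ring
  have hdisj : ∀ ε : ℂ, ε ^ 2 = 1 → Disjoint (range (q ε)) (range p) := by
    intro ε hε
    rw [Submodule.disjoint_def]
    rintro _ ⟨x, rfl⟩ ⟨y, hy⟩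
    by_contra hv
    have h1 : l • R halfTwist (q ε x) = ε • q ε x := by
      have := congrArg (· x) (hQq ε hε)
      rwa [hQdef] at this
    have h2 : k • R rotation (q ε x) = ζ • q ε x := by
      rw [← hy]
      exact congrArg (· y) (mul_cubeProj hP hζ)
    rw [← eq_inv_smul_iff₀ hl, smul_smul] at h1
    rw [← eq_inv_smul_iff₀ hk, smul_smul] at h2
    exact hV (finrank_eq_one_of_common_eigenvector hR hv h1 h2)
  have hle := fun ε hε => Submodule.finrank_add_finrank_le_of_disjoint (hdisj ε hε)
  have h1 := hle 1 (by norm_num)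
  have h2 := hle (-1) (by norm_num)
  have hsum : q 1 + q (-1) = 1 := by
    simp only [q]
    match_scalars <;> norm_num
  have htr := congrArg (trace ℂ V) hsum
  rw [map_add, trace_of_idem (hqq 1 (by norm_num)), trace_of_idem (hqq (-1) (by norm_num)),
    trace_one] at htr
  have htr' : finrank ℂ (range (q 1)) + finrank ℂ (range (q (-1))) = finrank ℂ V := by
    exact_mod_cast htr
  -- Each eigenspace of Q is disjoint from the range of p. Adding the two resulting bounds, with the
  -- ranks of `q 1` and `q (-1)` summing to the dimension, gives the claim.
  omega

/-- In an irreducible representation of dimension at most five, some multiple of `σ₁σ₂` has order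
three and is inverted by an involution. -/
theorem exists_involution_of_finrank_le (hR : R.IsIrreducible) (hV : finrank ℂ V ≤ 5) :
    ∃ k : ℂ, k ≠ 0 ∧ (k • R rotation) ^ 3 = 1 ∧
      ∃ S : End ℂ V, S ^ 2 = 1 ∧ S * (k • R rotation) * S = (k • R rotation) ^ 2 := by
  have := nontrivial_of_irreducible hR
  obtain ⟨c, hc⟩ := exists_eq_smul_one hR (R (halfTwist ^ 2)) (fun g => by
    rw [Commute, SemiconjBy, ← map_mul, ← map_mul, (halfTwist_sq_commute g).eq])
  have hc0 : c ≠ 0 := by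
    rintro rfl
    have h1 : R (halfTwist ^ 2)⁻¹ * R (halfTwist ^ 2) = 1 := by
      rw [← map_mul, inv_mul_cancel, map_one]
    rw [hc, zero_smul, mul_zero] at h1
    exact zero_ne_one h1
  -- The cube of the rotation and the square of the half twist are the same central element, acting
  -- by c, and so the same scalar normalises both.
  obtain ⟨k, hk⟩ := IsAlgClosed.exists_pow_nat_eq c⁻¹ (n := 3) (by norm_num)
  obtain ⟨l, hl⟩ := IsAlgClosed.exists_pow_nat_eq c⁻¹ (n := 2) (by norm_num)
  have hk0 : k ≠ 0 := by
    rintro rfl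
    exact inv_ne_zero hc0 (by rw [← hk]; norm_num)
  have hl0 : l ≠ 0 := by
    rintro rfl
    exact inv_ne_zero hc0 (by rw [← hl]; norm_num)
  have hP : (k • R rotation) ^ 3 = 1 := by
    rw [smul_pow, ← map_pow, rotation_cube, hc, smul_smul, hk, inv_mul_cancel₀ hc0, one_smul]
  have hQ : (l • R halfTwist) ^ 2 = 1 := by
    rw [smul_pow, ← map_pow, hc, smul_smul, hl, inv_mul_cancel₀ hc0, one_smul]
  have key : ∀ η : ℂ, η ^ 3 = 1 →
      finrank ℂ (range (cubeProj (om * η ^ 2) (k • R rotation))) =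
        finrank ℂ (range (cubeProj (om ^ 2 * η ^ 2) (k • R rotation))) →
      ∃ k : ℂ, k ≠ 0 ∧ (k • R rotation) ^ 3 = 1 ∧
        ∃ S : End ℂ V, S ^ 2 = 1 ∧ S * (k • R rotation) * S = (k • R rotation) ^ 2 := by
    intro η hη h
    have hη0 : η ≠ 0 := by rintro rfl; norm_num at hη
    have hP' : (η • k • R rotation) ^ 3 = 1 := by rw [smul_pow, hη, hP, one_smul]
    rw [← cubeProj_smul _ _ _ hη, ← cubeProj_smul _ _ _ hη] at h
    have hS := exists_involution hP' h
    rw [smul_smul] at hP' hS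
    exact ⟨η * k, mul_ne_zero hη0 hk0, hP', hS⟩
  have h4 : om ^ 2 * om ^ 2 = om := by linear_combination om * om_cube
  have h3 : om * om ^ 2 = 1 := by linear_combination om_cube
  have hsum := finrank_cubeProj_sum hP
  have hbound := fun (h : finrank ℂ V ≠ 1) (ζ : ℂ) (hζ : ζ ^ 3 = 1) =>
    two_mul_finrank_cubeProj_le hR h hk0 hl0 hP hQ hζ
  have hom2 : (om ^ 2) ^ 3 = 1 := by linear_combination (om ^ 3 + 1) * om_cube
  -- If the multiplicities were distinct, the largest being at most the sum of the other two would
  -- force the smallest to be at least 1, hence a total of at least 6. In dimension one the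
  -- half-dimension bound is unavailable, but two multiplicities vanish.
  have hcases : finrank ℂ (range (cubeProj om (k • R rotation))) =
        finrank ℂ (range (cubeProj (om ^ 2) (k • R rotation))) ∨
      finrank ℂ (range (cubeProj 1 (k • R rotation))) =
        finrank ℂ (range (cubeProj om (k • R rotation))) ∨
      finrank ℂ (range (cubeProj (om ^ 2) (k • R rotation))) =
        finrank ℂ (range (cubeProj 1 (k • R rotation))) := by
    by_cases h1 : finrank ℂ V = 1
    · omega
    · have b0 := hbound h1 1 (one_pow 3)
      have b1 := hbound h1 om om_cube
      have b2 := hbound h1 (om ^ 2) hom2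
      omega
  rcases hcases with h | h | h
  · exact key 1 (one_pow 3) (by rw [one_pow, mul_one, mul_one]; exact h)
  · refine key om om_cube ?_
    rw [h3, h4]; exact h
  · refine key (om ^ 2) hom2 ?_
    rw [show (om ^ 2) ^ 2 = om by rw [pow_two (om ^ 2), h4], ← pow_two,
      show om ^ 2 * om = 1 by rw [mul_comm, h3]]
    exact h

end Irreducible

/-! ### Standard extensions in dimension at most five. -/

/-- An irreducible representation of the braid group of dimension at most five has a standard
extension to the loop braid group. -/
theorem exists_standardExtension {d : ℕ} (hd : d ≤ 5) (ρ : B3 →* GL (Fin d) ℂ) (hρ : IsIrred ρ) :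
    ∃ ρ' : LB3 →* GL (Fin d) ℂ, IsStandardExtension ρ ρ' := by
  obtain ⟨k, hk, hP, S, hS, hSP⟩ := exists_involution_of_finrank_le hρ (by simpa using hd)
  let e : Matrix (Fin d) (Fin d) ℂ ≃ₐ[ℂ] End ℂ (Fin d → ℂ) := Matrix.toLinAlgEquiv'
  have he : linearRep ρ rotation = e (ρ rotation) := rfl
  rw [he, ← map_smul] at hP hSP
  rw [← e.apply_symm_apply S, ← map_pow] at hS
  rw [← e.apply_symm_apply S, ← map_mul, ← map_mul, ← map_pow] at hSP
  rw [← map_pow] at hP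
  have hS' : e.symm S ^ 2 = 1 := e.injective (by rw [hS, map_one])
  have hP' := e.injective (hP.trans (map_one e).symm)
  have hSP' := e.injective hSP
  -- The scalar matrix k serves as the central element of `exists_extension`.
  let z : GL (Fin d) ℂ := Units.map (algebraMap ℂ (Matrix (Fin d) (Fin d) ℂ)).toMonoidHom
    (Units.mk0 k hk)
  have hz : ∀ M : GL (Fin d) ℂ, ((z * M : GL (Fin d) ℂ) : Matrix (Fin d) (Fin d) ℂ) = k • M :=
    fun M => (Algebra.smul_def k _).symm
  have hzc : ∀ M : GL (Fin d) ℂ, z * M = M * z := fun M => Units.ext (Algebra.commutes k _)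
  let s : GL (Fin d) ℂ := ⟨e.symm S, e.symm S, by rw [← pow_two, hS'], by rw [← pow_two, hS']⟩
  obtain ⟨ρ', h1, h2⟩ := exists_extension ρ z s (fun g => hzc _)
    (Units.ext (by
      rw [Units.val_pow_eq_pow_val, hz]
      exact hP')) (hzc s) (Units.ext hS')
    (Units.ext (by
      rw [Units.val_pow_eq_pow_val, Units.val_mul, Units.val_mul, hz]
      exact hSP'))
  exact ⟨ρ', h1, k, by rw [h2, hz]⟩

/-! ### The six-dimensional example: irreducibility and absence of extensions. -/

/-- The image of `σ₁` in the six dimensional example, as an invertible matrix. -/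
noncomputable def unitA : GL (Fin 6) ℂ :=
  ⟨toC eA, toC eAinv, by rw [← toC_mul, eA_mul_eAinv, toC_one],
    by rw [← toC_mul, eAinv_mul_eA, toC_one]⟩

/-- The image of `σ₂` in the six dimensional example, as an invertible matrix. -/
noncomputable def unitB : GL (Fin 6) ℂ :=
  ⟨toC eB, toC eBinv, by rw [← toC_mul, eB_mul_eBinv, toC_one],
    by rw [← toC_mul, mul_eq_one_comm.mp eB_mul_eBinv, toC_one]⟩

/-- The six dimensional representation of the braid group given by `exA` and `exB`. -/
noncomputable def exRep : B3 →* GL (Fin 6) ℂ :=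
  braidLift unitA unitB (Units.ext (by
    change toC eA * toC eB * toC eA = toC eB * toC eA * toC eB
    simp only [← toC_mul, eA_mul_eB_mul_eA, eB_mul_eA_mul_eB]))

theorem exRep_sigma₁ : exRep (PresentedGroup.of BraidGen.sigma₁) = unitA :=
  braidLift_sigma₁ _ _ _

theorem exRep_sigma₂ : exRep (PresentedGroup.of BraidGen.sigma₂) = unitB :=
  braidLift_sigma₂ _ _ _

theorem exists_exRep_eq_eF (k : Fin 6) :
    ∃ g, (exRep g : Matrix (Fin 6) (Fin 6) ℂ) = toC (eF k) := by
  let a : B3 := PresentedGroup.of BraidGen.sigma₁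
  have ha : exRep a = unitA := exRep_sigma₁
  have h1 : (exRep a : Matrix (Fin 6) (Fin 6) ℂ) = toC eA := by rw [ha]; rfl
  have h1' : (exRep a⁻¹ : Matrix (Fin 6) (Fin 6) ℂ) = toC eAinv := by rw [map_inv, ha]; rfl
  have h2 : (exRep (a * a) : Matrix (Fin 6) (Fin 6) ℂ) = toC eA2 := by
    rw [map_mul, Units.val_mul, h1, ← toC_mul, eA_mul_eA]
  have h2' : (exRep (a⁻¹ * a⁻¹) : Matrix (Fin 6) (Fin 6) ℂ) = toC eAinv2 := by
    rw [map_mul, Units.val_mul, h1', ← toC_mul, eAinv_mul_eAinv]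
  have h3 : (exRep (a * a * a) : Matrix (Fin 6) (Fin 6) ℂ) = toC eA3 := by
    rw [map_mul, Units.val_mul, h2, h1, ← toC_mul, eA2_mul_eA]
  fin_cases k
  exacts [⟨a, h1⟩, ⟨a⁻¹, h1'⟩, ⟨1, by rw [map_one]; exact toC_one.symm⟩, ⟨a * a, h2⟩,
    ⟨a⁻¹ * a⁻¹, h2'⟩, ⟨a * a * a, h3⟩]

theorem toC_eigenprojection_eY :
    1 + om • toC eY + (-1 - om) • (toC eY * toC eY) = (-3 : ℂ) • (toC eU * toC eL) := by
  have hs : ∀ (c : Eis) (M : Matrix (Fin 6) (Fin 6) Eis), toC (c • M) = eisHom c • toC M :=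
    fun c M => by ext i j; simp
  have ha : ∀ M N : Matrix (Fin 6) (Fin 6) Eis, toC (M + N) = toC M + toC N :=
    fun M N => Matrix.map_add _ (map_add _) M N
  have h3 : eisHom (-3) = -3 := by rw [map_neg, map_ofNat]
  have h := congrArg toC eigenprojection_eY
  simp only [ha, hs, toC_one, toC_mul, eisHom_mk, h3] at h
  rw [← h]
  push_cast
  module

/-- An invariant subspace W is stable under the rank-one operator `toC eU * toC eL`, a polynomial in
the image of `σ₁σ₂`. If W contains the vector u, it contains the basis `eF k * eU`. Otherwise the
functional `eL`, and hence every `eL * eF k`, vanishes on W, and these six functionals have only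
zero in common. -/
theorem irreducible_exRep : IsIrred exRep := by
  have hY : (exRep rotation : Matrix (Fin 6) (Fin 6) ℂ) = toC eY := by
    rw [rotation, map_mul, exRep_sigma₁, exRep_sigma₂, ← eA_mul_eB, toC_mul]
    rfl
  have key : ∀ W : Submodule ℂ (Fin 6 → ℂ), (∀ g, ∀ v ∈ W, linearRep exRep g v ∈ W) →
      W = ⊥ ∨ W = ⊤ := by
    intro W hW
    have hF : ∀ k, ∀ v ∈ W, (toC (eF k)).mulVec v ∈ W := by
      intro k v hv
      obtain ⟨g, hg⟩ := exists_exRep_eq_eF k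
      rw [← hg]
      exact hW g v hv
    have hYW : ∀ v ∈ W, (toC eY).mulVec v ∈ W := by
      intro v hv
      rw [← hY]
      exact hW rotation v hv
    let u : Fin 6 → ℂ := fun i => toC eU i 0
    have hU : ∀ w : Fin 1 → ℂ, (toC eU).mulVec w = w 0 • u := by
      intro w
      funext i
      simp only [Matrix.mulVec, dotProduct, Fin.sum_univ_one, Pi.smul_apply, smul_eq_mul]
      exact mul_comm _ _
    have hproj : ∀ v, v + om • (toC eY).mulVec v +
        (-1 - om) • (toC eY).mulVec ((toC eY).mulVec v) =
        (-3 * (toC eL).mulVec v 0) • u := by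
      intro v
      have h := congrArg (fun M => M.mulVec v) toC_eigenprojection_eY
      simp only [Matrix.add_mulVec, Matrix.one_mulVec, Matrix.smul_mulVec,
        ← Matrix.mulVec_mulVec] at h
      rw [h, hU, smul_smul]
    by_cases hu : u ∈ W
    · right
      rw [eq_top_iff]
      intro x _
      have hx : (toC eK).mulVec ((24 : ℂ)⁻¹ • (toC eKadj).mulVec x) = x := by
        rw [Matrix.mulVec_smul, Matrix.mulVec_mulVec, ← toC_mul, eK_mul_eKadj, toC_ofNat,
          Matrix.smul_mulVec, Matrix.one_mulVec, smul_smul]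
        norm_num
      rw [← hx, Matrix.mulVec_eq_sum]
      refine Submodule.sum_mem _ fun k _ => ?_
      have hk : (toC eK).transpose k = (toC (eF k)).mulVec u := by
        funext i
        exact (toC_eF_mul_eU k i).symm
      rw [op_smul_eq_smul, hk]
      exact W.smul_mem _ (hF k u hu)
    · left
      rw [eq_bot_iff]
      intro x hx
      have h0 : ∀ y ∈ W, (toC eL).mulVec y 0 = 0 := by
        intro y hy
        by_contra hne
        have h1 : (-3 * (toC eL).mulVec y 0) • u ∈ W := by
          rw [← hproj]
          exact W.add_mem (W.add_mem hy (W.smul_mem _ (hYW y hy)))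
            (W.smul_mem _ (hYW _ (hYW y hy)))
        exact hu ((W.smul_mem_iff (mul_ne_zero (by norm_num) hne)).mp h1)
      have hR : (toC eR).mulVec x = 0 := by
        funext k
        have h1 := h0 _ (hF k x hx)
        rw [Matrix.mulVec_mulVec] at h1
        rw [Pi.zero_apply, ← h1]
        simp only [Matrix.mulVec, dotProduct, toC_eL_mul_eF]
      have h24 : (24 : ℂ) • x = 0 := by
        rw [← Matrix.one_mulVec x, ← Matrix.smul_mulVec, ← toC_ofNat, ← eRadj_mul_eR, toC_mul,
          ← Matrix.mulVec_mulVec, hR, Matrix.mulVec_zero]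
      exact (smul_eq_zero.mp h24).resolve_left (by norm_num)
  refine { exists_pair_ne := ⟨⊥, ⊤, fun h => ?_⟩, eq_bot_or_eq_top := fun W => ?_ }
  · exact bot_ne_top (α := Submodule ℂ (Fin 6 → ℂ)) (congrArg Subrepresentation.toSubmodule h)
  · rcases key W.toSubmodule fun g v hv => W.apply_mem_toSubmodule g hv with h | h
    · exact Or.inl (Subrepresentation.toSubmodule_injective h)
    · exact Or.inr (Subrepresentation.toSubmodule_injective h)

/-- The element `s₁s₂` has cube 1 and square `s₂s₁`. The images of `s₁s₂` and `s₂s₁` have the same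
trace, which is the trace condition that rules out the example. -/
theorem not_isExtension_exRep (ρ' : LB3 →* GL (Fin 6) ℂ) : ¬ IsExtension exRep ρ' := by
  intro h
  obtain ⟨hst, hs, ht, hsta⟩ := loop_relations
  set s : LB3 := PresentedGroup.of LoopGen.s₁
  set t : LB3 := PresentedGroup.of LoopGen.s₂
  have hA : ρ' (PresentedGroup.of LoopGen.sigma₁) = unitA := by
    rw [← exRep_sigma₁, ← h, MonoidHom.comp_apply, incl_sigma₁]
  have hB : ρ' (PresentedGroup.of LoopGen.sigma₂) = unitB := by
    rw [← exRep_sigma₂, ← h, MonoidHom.comp_apply, incl_sigma₂]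
  rw [pow_two] at hs ht
  have hcube : s * t * (s * t) * (s * t) = 1 := by
    calc s * t * (s * t) * (s * t) = s * t * s * (t * s * t) := by simp only [mul_assoc]
      _ = s * t * s * (s * t * s) := by rw [hst]
      _ = s * (t * (s * s) * t) * s := by simp only [mul_assoc]
      _ = 1 := by rw [hs, mul_one, ht, mul_one, hs]
  have hsq : s * t * (s * t) = t * s := by
    calc s * t * (s * t) = s * t * s * t := by simp only [mul_assoc]
      _ = t * s * (t * t) := by rw [hst]; simp only [mul_assoc]
      _ = t * s := by rw [ht, mul_one]
  refine not_commute_of_cube_eq_one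
    (P := ((ρ' s : Matrix (Fin 6) (Fin 6) ℂ) * (ρ' t : Matrix (Fin 6) (Fin 6) ℂ))) ?_ ?_ ?_
  · have := congrArg Units.val (congrArg ρ' hsta)
    simp only [map_mul, hA, hB, Units.val_mul, mul_assoc] at this ⊢
    exact this
  · have := congrArg Units.val (congrArg ρ' hcube)
    simpa only [map_mul, map_one, Units.val_mul, Units.val_one] using this
  · have := congrArg Units.val (congrArg ρ' hsq)
    simp only [map_mul, Units.val_mul] at this
    rw [this, Matrix.trace_mul_comm]

end LoopBraid

theorem mainTheorem1 :
    (∀ (d : ℕ), d ≤ 5 → ∀ ρ : LoopBraid.B3 →* GL (Fin d) ℂ, LoopBraid.IsIrred ρ →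
      ∃ ρ' : LoopBraid.LB3 →* GL (Fin d) ℂ, LoopBraid.IsStandardExtension ρ ρ') ∧
    (∃ ρ : LoopBraid.B3 →* GL (Fin 6) ℂ,
      (ρ (PresentedGroup.of LoopBraid.BraidGen.sigma₁) : Matrix (Fin 6) (Fin 6) ℂ) =
        LoopBraid.exA ∧
      (ρ (PresentedGroup.of LoopBraid.BraidGen.sigma₂) : Matrix (Fin 6) (Fin 6) ℂ) =
        LoopBraid.exB ∧
      LoopBraid.IsIrred ρ ∧
      ¬ ∃ ρ' : LoopBraid.LB3 →* GL (Fin 6) ℂ, LoopBraid.IsExtension ρ ρ') := by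
  refine ⟨fun d hd ρ hρ => LoopBraid.exists_standardExtension hd ρ hρ, LoopBraid.exRep, ?_, ?_,
    LoopBraid.irreducible_exRep, fun ⟨ρ', h⟩ => LoopBraid.not_isExtension_exRep ρ' h⟩
  · rw [LoopBraid.exRep_sigma₁, ← LoopBraid.toC_eA]; rfl
  · rw [LoopBraid.exRep_sigma₂, ← LoopBraid.toC_eB]; rfl
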